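/- Let $T\in M(n;\mathbb C)$ be a singular matrix whose imaginary part is positive definite ($x^t(\mathrm{Im}\,T)x>0$ for all real $x\neq 0$), let $\delta\in M(n;\mathbb Z)$ with $\det(T-\delta)\neq 0$, and put $T'=(-T+\delta)^{-1}$. For $\tau=T,T'$ let $T^{2n}_{J=\tau}=\mathbb C^n/2\pi(\mathbb Z^n\oplus\tau\mathbb Z^n)$, and let $\varphi:T^{2n}_{J=T}\to T^{2n}_{J=T'}$ be the biholomorphic map $\varphi(z)=(-T+\delta)^{-1}z$. Let $r$ be a positive integer, $\zeta=e^{2\pi\mathbf i/r}$, $\mu\in\mathbb C^n$, and let $A=(a_{ij})\in M(n;\mathbb Z)$ satisfy $AT'=(AT')^t$. Let $\tilde a_1\mid\tilde a_2\mid\cdots\mid\tilde a_n$ ($\tilde a_i\ge 0$) be the diagonal entries of the Smith normal form of $A$, and let $r'=\prod_i r/\gcd(r,\tilde a_i)$. (a) Let $\mathcal U$ be a family of unitary matrices $V_j,U_k\in U(r')$ $(1\le j,k\le n)$ with $V_jV_k=V_kV_j$, $U_jU_k=U_kU_j$, $\zeta^{-a_{kj}}U_kV_j=V_jU_k$. Let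 $E_{(r,A,\mu,\mathcal U)}\to T^{2n}_{J=T'}$ be the complex vector bundle of rank $r'$ whose sections, in the real coordinates $Z=X+T'Y$, satisfy $$s(X+2\pi e_j,Y)=e^{\frac{\mathbf i}{r}\sum_i a_{ij}Y_i}V_j\,s(X,Y),\qquad s(X,Y+2\pi e_k)=U_k\,s(X,Y),$$ with the connection $\nabla=d-\frac{\mathbf i}{2\pi}\bigl(\frac1rX^tA^t+\frac1r\mu^t\bigr)dY\cdot I_{r'}$. (b) Let $L=2\pi(\mathbb Z^n\oplus T\mathbb Z^n)$, with generators $\gamma_j=2\pi e_j$, $\gamma'_k=2\pi Te_k$, let $R=\frac{\mathbf i}{2\pi}\frac{r'}{r}\{(T-\bar T)^{-1}\}^tA^t$ and $\mathcal R(z,w)=\sum_{i,j}R_{ij}z_i\bar w_j$. Given unitary matrices $U(\gamma_j),U(\gamma'_k)\in U(r')$ with $$U(\gamma_j)U(\gamma_k)=U(\gamma_k)U(\gamma_j),\quad U(\gamma'_j)U(\gamma'_k)=\zeta^{(A^t\delta)_{jk}-(A^t\delta)_{kj}}U(\gamma'_k)U(\gamma'_j),\quad \zeta^{-a_{jk}}U(\gamma'_k)U(\gamma_j)=U(\gamma_j)U(\gamma'_k),$$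 there is exactly one extension $U:L\to U(r')$ for which $$j(\gamma,z)=U(\gamma)\exp\Bigl\{\tfrac1{r'}\mathcal R(z,\gamma)+\tfrac1{2r'}\mathcal R(\gamma,\gamma)\Bigr\}$$ is a factor of automorphy, i.e. $j(\gamma+\gamma',z)=j(\gamma,z+\gamma')j(\gamma',z)$. Let $\mathcal E_{(r,A,\mu,\mathcal U)}\to T^{2n}_{J=T}$ be the holomorphic vector bundle of rank $r'$ defined by $j$, with the connection $$\tilde\nabla=d-\tfrac1{r'}dz^tR\bar z\cdot I_{r'}-\tfrac{\mathbf i}{2\pi r}\mu^t(\delta-\bar T)(T-\bar T)^{-1}dz\cdot I_{r'}+\tfrac{\mathbf i}{2\pi r}\bar\mu^t(\delta-\bar T)(T-\bar T)^{-1}dz\cdot I_{r'}.$$ Then there is a bijection between the families $\mathcal U$ in (a) and the families in (b) such that, for corresponding families, $\varphi^*E_{(r,A,\mu,\mathcal U)}$ is a holomorphic vector bundle, $\mathcal E_{(r,A,\mu,\mathcal U)}$ is projectively flat (its curvature is a scalar 2-form times $I_{r'}$), and $$\varphi^*E_{(r,A,\mu,\mathcal U)}\cong\mathcal E_{(r,A,\mu,\mathcal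 U)}.$$ An isomorphism $\Psi$, both of holomorphic vector bundles and of bundles with connection ($\tilde\nabla\Psi=\Psi\,\varphi^*\nabla$), is expressed locally as $$\Psi(z,\bar z)=\exp\Bigl\{\tfrac{\mathbf i}{4\pi r'}z^t\bar{\mathcal A}z+\tfrac{\mathbf i}{4\pi r'}\bar z^t\mathcal A\bar z-\tfrac{\mathbf i}{2\pi r'}z^t\mathcal A\bar z+\tfrac{\mathbf i}{2\pi r}\bar z^t\{(T-\bar T)^{-1}\}^t(\delta-T)^t\mu-\tfrac{\mathbf i}{2\pi r}z^t\{(T-\bar T)^{-1}\}^t(\delta-\bar T)^t\bar\mu\Bigr\}\cdot I_{r'},$$ where $\mathcal A=\frac{r'}{r}\{(T-\bar T)^{-1}\}^tA^t(\delta-T)(T-\bar T)^{-1}$. -/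

import Mathlib

open Matrix Complex
open scoped ContDiff ComplexConjugate

/-! ### Complex tori -/

/-- The group of periods `ℤⁿ ⊕ ℤⁿ`; `(a, b)` stands for the lattice vector `2π(a + τ b)`. -/
abbrev Period (n : ℕ) : Type := (Fin n → ℤ) × (Fin n → ℤ)

/-- The lattice vector `2π(a + τ b)`. -/
noncomputable def period {n : ℕ} (τ : Matrix (Fin n) (Fin n) ℂ) : Period n →+ (Fin n → ℂ) where
  toFun γ := (2 * (Real.pi : ℂ)) • ((fun i => (γ.1 i : ℂ)) + τ *ᵥ (fun i => (γ.2 i : ℂ)))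
  map_zero' := by ext i; simp [Matrix.mulVec, dotProduct]
  map_add' γ γ' := by
    ext i
    simp [Matrix.mulVec, dotProduct, mul_add, Finset.sum_add_distrib]
    ring

/-- The complex torus `ℂⁿ / 2π(ℤⁿ ⊕ τ ℤⁿ)`. -/
abbrev Torus {n : ℕ} (τ : Matrix (Fin n) (Fin n) ℂ) : Type :=
  (Fin n → ℂ) ⧸ (period τ).range

/-- A biholomorphic isomorphism of complex tori: a `ℂ`-linear automorphism `lin` of `ℂⁿ` that
carries the lattice onto the lattice, through the isomorphism `per` of the period groups. -/
structure TorusIso {n : ℕ} (τ τ' : Matrix (Fin n) (Fin n) ℂ) where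
  lin : (Fin n → ℂ) ≃ₗ[ℂ] (Fin n → ℂ)
  per : Period n ≃+ Period n
  lin_period : ∀ γ, lin (period τ γ) = period τ' (per γ)

/-- The induced map of the quotient tori. -/
noncomputable def TorusIso.toAddEquiv {n : ℕ} {τ τ' : Matrix (Fin n) (Fin n) ℂ}
    (f : TorusIso τ τ') : Torus τ ≃+ Torus τ' :=
  QuotientAddGroup.congr _ _ f.lin.toAddEquiv (by
    ext w
    constructor
    · rintro ⟨_, ⟨γ, rfl⟩, rfl⟩
      exact ⟨f.per γ, (f.lin_period γ).symm⟩
    · rintro ⟨γ, rfl⟩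
      refine ⟨_, ⟨f.per.symm γ, rfl⟩, ?_⟩
      have := f.lin_period (f.per.symm γ)
      simpa using this)

/-! ### Complex vector bundles with connection on a complex torus -/

/-- A smooth complex vector bundle of rank `N` with a connection on `ℂⁿ / 2π(ℤⁿ ⊕ τ ℤⁿ)`, given on
the universal covering `ℂⁿ`: sections are the maps `s : ℂⁿ → ℂᴺ` with
`s (z + γ) = factor γ z • s z`, and the connection is `∇ = d + conn`. The last field says
that `∇ s` obeys the same transformation rule as `s`. -/
structure TorusBundle {n : ℕ} (τ : Matrix (Fin n) (Fin n) ℂ) (N : ℕ) where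
  factor : Period n → (Fin n → ℂ) → Matrix (Fin N) (Fin N) ℂ
  conn : (Fin n → ℂ) → (Fin n → ℂ) →ₗ[ℝ] Matrix (Fin N) (Fin N) ℂ
  factor_zero : ∀ z, factor 0 z = 1
  factor_add : ∀ γ γ' z, factor (γ + γ') z = factor γ (z + period τ γ') * factor γ' z
  factor_smooth : ∀ γ i j, ContDiff ℝ ∞ (fun z => factor γ z i j)
  conn_smooth : ∀ v i j, ContDiff ℝ ∞ (fun z => conn z v i j)
  conn_factor : ∀ γ z v i j,
    fderiv ℝ (fun w => factor γ w i j) z v + (conn (z + period τ γ) v * factor γ z) i j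
      = (factor γ z * conn z v) i j

namespace TorusBundle

variable {n N : ℕ} {τ τ' : Matrix (Fin n) (Fin n) ℂ}

/-- Two points of `ℂⁿ × ℂᴺ` are identified when a period carries one to the other. -/
def setoid (B : TorusBundle τ N) : Setoid ((Fin n → ℂ) × (Fin N → ℂ)) where
  r p q := ∃ γ, q = (p.1 + period τ γ, B.factor γ p.1 *ᵥ p.2)
  iseqv := {
    refl := fun p => ⟨0, by simp [B.factor_zero]⟩
    symm := by
      rintro p q ⟨γ, rfl⟩
      refine ⟨-γ, ?_⟩
      have h := B.factor_add (-γ) γ p.1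
      rw [neg_add_cancel, B.factor_zero] at h
      simp [Matrix.mulVec_mulVec, ← h]
    trans := by
      rintro p q s ⟨γ, rfl⟩ ⟨γ', rfl⟩
      refine ⟨γ' + γ, ?_⟩
      simp [B.factor_add, Matrix.mulVec_mulVec, add_assoc, add_comm (period τ γ)] }

/-- The total space `(ℂⁿ × ℂᴺ) / (ℤⁿ ⊕ ℤⁿ)` with the quotient topology. -/
def TotalSpace (B : TorusBundle τ N) : Type := Quotient B.setoid

instance (B : TorusBundle τ N) : TopologicalSpace B.TotalSpace :=
  inferInstanceAs (TopologicalSpace (Quotient B.setoid))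

/-- The class of `(z, v)`. -/
def pt (B : TorusBundle τ N) (z : Fin n → ℂ) (v : Fin N → ℂ) : B.TotalSpace :=
  Quotient.mk B.setoid (z, v)

/-- The projection to the torus. -/
noncomputable def proj (B : TorusBundle τ N) : B.TotalSpace → Torus τ :=
  Quotient.lift (fun p => (QuotientAddGroup.mk p.1 : Torus τ)) (by
    rintro p q ⟨γ, rfl⟩
    exact QuotientAddGroup.eq.2 ⟨γ, by simp⟩)

/-- The covariant derivative `∇_v s = ds(v) + conn(v) s` of a local section. -/
noncomputable def covDeriv (B : TorusBundle τ N) (s : (Fin n → ℂ) → (Fin N → ℂ))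
    (z v : Fin n → ℂ) : Fin N → ℂ :=
  fderiv ℝ s z v + B.conn z v *ᵥ s z

/-- Twice the `(0,1)`-part of the covariant derivative: `∇_v s + i ∇_{iv} s`. -/
noncomputable def dbar (B : TorusBundle τ N) (s : (Fin n → ℂ) → (Fin N → ℂ))
    (z v : Fin n → ℂ) : Fin N → ℂ :=
  B.covDeriv s z v + I • B.covDeriv s z (I • v)

/-- The curvature form `dω + ω ∧ ω`, `ω` the connection form, on two tangent vectors. -/
noncomputable def curvature (B : TorusBundle τ N) (z u v : Fin n → ℂ) :
    Matrix (Fin N) (Fin N) ℂ :=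
  Matrix.of (fun i j => fderiv ℝ (fun w => B.conn w v i j) z u
      - fderiv ℝ (fun w => B.conn w u i j) z v)
    + (B.conn z u * B.conn z v - B.conn z v * B.conn z u)

/-- The connection is projectively flat: its curvature is a scalar 2-form times the identity. -/
def IsProjectivelyFlat (B : TorusBundle τ N) : Prop :=
  ∃ α : (Fin n → ℂ) → (Fin n → ℂ) → (Fin n → ℂ) → ℂ, ∀ z u v, B.curvature z u v = α z u v • 1

/-- The `(0,2)`-part of the curvature vanishes: the `(0,1)`-part of the connection is
the `∂̄`-operator of a holomorphic vector bundle. -/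
def IsHolomorphic (B : TorusBundle τ N) : Prop :=
  ∀ z u v, B.curvature z u v + I • B.curvature z (I • u) v + I • B.curvature z u (I • v)
    - B.curvature z (I • u) (I • v) = 0

/-- The pullback `f^*B` of a bundle with connection along an isomorphism of tori. -/
noncomputable def pullback (f : TorusIso τ τ') (B : TorusBundle τ' N) : TorusBundle τ N where
  factor γ z := B.factor (f.per γ) (f.lin z)
  conn z := (B.conn (f.lin z)).comp (f.lin.toLinearMap.restrictScalars ℝ)
  factor_zero z := by simp [B.factor_zero]
  factor_add γ γ' z := by simp [B.factor_add, f.lin_period]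
  factor_smooth γ i j := (B.factor_smooth (f.per γ) i j).comp
    (f.lin.toLinearMap.restrictScalars ℝ).toContinuousLinearMap.contDiff
  conn_smooth v i j := (B.conn_smooth (f.lin v) i j).comp
    (f.lin.toLinearMap.restrictScalars ℝ).toContinuousLinearMap.contDiff
  conn_factor γ z v i j := by
    have h := B.conn_factor (f.per γ) (f.lin z) (f.lin v) i j
    set L := (f.lin.toLinearMap.restrictScalars ℝ).toContinuousLinearMap with hL
    have hd : fderiv ℝ (fun w => B.factor (f.per γ) (f.lin w) i j) z v
        = fderiv ℝ (fun w => B.factor (f.per γ) w i j) (f.lin z) (f.lin v) := by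
      have h1 : DifferentiableAt ℝ (fun w => B.factor (f.per γ) w i j) (L z) :=
        ((B.factor_smooth (f.per γ) i j).differentiable (by simp)).differentiableAt
      have h2 := h1.hasFDerivAt.comp z L.hasFDerivAt
      have h3 := h2.fderiv
      exact congrArg (fun l => l v) h3
    rw [hd]
    simpa [f.lin_period] using h

/-- The canonical map `f^*B → B`. -/
noncomputable def pullbackMap (f : TorusIso τ τ') (B : TorusBundle τ' N) :
    (pullback f B).TotalSpace → B.TotalSpace :=
  Quotient.lift (fun p => B.pt (f.lin p.1) p.2) (by
    rintro p q ⟨γ, rfl⟩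
    exact Quotient.sound ⟨f.per γ, by simp [f.lin_period, pullback]⟩)

/-- `f^*B` is the pullback of `B`: each of its points is determined by its images in the torus
and in the total space of `B`, and these are the pairs of points over the same point. -/
theorem pullback_isPullback (f : TorusIso τ τ') (B : TorusBundle τ' N)
    (hτ' : Function.Injective (period τ')) :
    (∀ p, B.proj (pullbackMap f B p) = f.toAddEquiv ((pullback f B).proj p)) ∧
    ∀ (x : Torus τ) (q : B.TotalSpace), B.proj q = f.toAddEquiv x →
      ∃! p, (pullback f B).proj p = x ∧ pullbackMap f B p = q := by
  refine ⟨?_, ?_⟩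
  · rintro ⟨z, v⟩
    rfl
  · intro x q hq
    obtain ⟨z, rfl⟩ := QuotientAddGroup.mk_surjective x
    obtain ⟨⟨Z, v⟩, rfl⟩ := Quotient.exists_rep q
    obtain ⟨γ, hγ⟩ : ∃ γ, period τ' γ = -Z + f.lin z := QuotientAddGroup.eq.1 hq
    refine ⟨(pullback f B).pt z (B.factor γ Z *ᵥ v), ⟨rfl, ?_⟩, ?_⟩
    · exact Quotient.sound (B.setoid.symm ⟨γ, by simp [hγ]⟩)
    · rintro ⟨z', v'⟩ ⟨h1, h2⟩
      obtain ⟨δ, hδ⟩ : ∃ δ, period τ δ = -z' + z := QuotientAddGroup.eq.1 h1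
      obtain ⟨ε, hε⟩ := Quotient.exact h2
      obtain ⟨h3, h4⟩ := Prod.ext_iff.1 hε
      simp only at h3 h4
      subst h3 h4
      obtain rfl : z = z' + period τ δ := by rw [hδ]; abel
      have h5 : γ + ε = f.per δ := by
        apply hτ'
        rw [map_add, hγ, map_add, f.lin_period]
        abel
      refine Quotient.sound ⟨δ, ?_⟩
      simp [pullback, ← h5, B.factor_add, Matrix.mulVec_mulVec]

/-- An isomorphism of smooth vector bundles with connection: a homeomorphism of the total spaces
over the torus that lifts to `(z, v) ↦ (z, Ψ(z) v)` for a smooth matrix function `Ψ` (its local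
expression), and that carries the connection to the connection: `∇ ∘ Ψ = Ψ ∘ ∇`. -/
structure Iso (B C : TorusBundle τ N) where
  toHomeomorph : B.TotalSpace ≃ₜ C.TotalSpace
  proj_comp : ∀ p, C.proj (toHomeomorph p) = B.proj p
  lift : (Fin n → ℂ) → Matrix (Fin N) (Fin N) ℂ
  lift_smooth : ∀ i j, ContDiff ℝ ∞ (fun z => lift z i j)
  map_mk : ∀ z v, toHomeomorph (B.pt z v) = C.pt z (lift z *ᵥ v)
  parallel : ∀ z v i j,
    fderiv ℝ (fun w => lift w i j) z v + (C.conn z v * lift z) i j = (lift z * B.conn z v) i j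

end TorusBundle

/-! ### Real coordinates and the isomorphism `φ` -/

section Coordinates

variable {n : ℕ}

/-- The real coordinate `Y` of `Z = X + τ Y`. -/
noncomputable def coordY (τ : Matrix (Fin n) (Fin n) ℂ) : (Fin n → ℂ) →ₗ[ℝ] (Fin n → ℝ) where
  toFun Z := (τ.map Complex.im)⁻¹ *ᵥ (fun i => (Z i).im)
  map_add' Z W := by rw [← Matrix.mulVec_add]; rfl
  map_smul' c Z := by
    rw [RingHom.id_apply, ← Matrix.mulVec_smul]
    congr 1
    ext i
    simp

/-- The real coordinate `X` of `Z = X + τ Y`. -/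
noncomputable def coordX (τ : Matrix (Fin n) (Fin n) ℂ) : (Fin n → ℂ) →ₗ[ℝ] (Fin n → ℝ) where
  toFun Z := (fun i => (Z i).re) - τ.map Complex.re *ᵥ coordY τ Z
  map_add' Z W := by
    rw [map_add, Matrix.mulVec_add]
    ext i
    simp
    ring
  map_smul' c Z := by
    rw [map_smul, Matrix.mulVec_smul]
    ext i
    simp
    ring

theorem coord_spec {τ : Matrix (Fin n) (Fin n) ℂ} (hτ : (τ.map Complex.im).det ≠ 0)
    (Z : Fin n → ℂ) (X Y : Fin n → ℝ) :
    (fun i => (X i : ℂ)) + τ *ᵥ (fun i => (Y i : ℂ)) = Z ↔ X = coordX τ Z ∧ Y = coordY τ Z := by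
  have hu : IsUnit (τ.map Complex.im).det := isUnit_iff_ne_zero.2 hτ
  have key : (fun i => (X i : ℂ)) + τ *ᵥ (fun i => (Y i : ℂ)) = Z ↔
      (X + τ.map Complex.re *ᵥ Y = fun i => (Z i).re) ∧
        (τ.map Complex.im *ᵥ Y = fun i => (Z i).im) := by
    simp only [funext_iff, ← forall_and]
    refine forall_congr' fun i => ?_
    simp [Complex.ext_iff, Matrix.mulVec, dotProduct]
  have hY : (τ.map Complex.im *ᵥ Y = fun i => (Z i).im) ↔ Y = coordY τ Z := by
    constructor
    · intro h
      change Y = (τ.map Complex.im)⁻¹ *ᵥ (fun i => (Z i).im)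
      rw [← h, Matrix.mulVec_mulVec, Matrix.nonsing_inv_mul _ hu, Matrix.one_mulVec]
    · rintro rfl
      change τ.map Complex.im *ᵥ ((τ.map Complex.im)⁻¹ *ᵥ (fun i => (Z i).im)) = _
      rw [Matrix.mulVec_mulVec, Matrix.mul_nonsing_inv _ hu, Matrix.one_mulVec]
  rw [key, hY]
  constructor
  · rintro ⟨h, rfl⟩
    exact ⟨eq_sub_of_add_eq h, rfl⟩
  · rintro ⟨rfl, rfl⟩
    exact ⟨sub_add_cancel _ _, rfl⟩

theorem coord_period {τ : Matrix (Fin n) (Fin n) ℂ} (hτ : (τ.map Complex.im).det ≠ 0)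
    (γ : Period n) :
    coordX τ (period τ γ) = (fun i => 2 * Real.pi * (γ.1 i : ℝ)) ∧
      coordY τ (period τ γ) = (fun i => 2 * Real.pi * (γ.2 i : ℝ)) := by
  have h := (coord_spec hτ (period τ γ) (fun i => 2 * Real.pi * (γ.1 i : ℝ))
    (fun i => 2 * Real.pi * (γ.2 i : ℝ))).1 (by
      ext i
      simp [period, Matrix.mulVec, dotProduct, Finset.mul_sum]
      refine Finset.sum_congr rfl fun j _ => by ring)
  exact ⟨h.1.symm, h.2.symm⟩

theorem period_injective {τ : Matrix (Fin n) (Fin n) ℂ} (hτ : (τ.map Complex.im).det ≠ 0) :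
    Function.Injective (period τ) := by
  intro γ γ' h
  have h1 := coord_period hτ γ
  rw [h] at h1
  have h2 := coord_period hτ γ'
  have e1 := h1.1.symm.trans h2.1
  have e2 := h1.2.symm.trans h2.2
  have hpi : (2 * Real.pi) ≠ 0 := by positivity
  ext i
  · simpa [hpi] using congrFun e1 i
  · simpa [hpi] using congrFun e2 i

/-- An integer matrix as a complex matrix. -/
def toC (M : Matrix (Fin n) (Fin n) ℤ) : Matrix (Fin n) (Fin n) ℂ := M.map (Int.cast : ℤ → ℂ)

/-- `T' = (-T + δ)⁻¹`. -/
noncomputable def primed (T : Matrix (Fin n) (Fin n) ℂ) (δ : Matrix (Fin n) (Fin n) ℤ) :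
    Matrix (Fin n) (Fin n) ℂ :=
  (-T + toC δ)⁻¹

theorem det_neg_add_ne_zero {T : Matrix (Fin n) (Fin n) ℂ} {δ : Matrix (Fin n) (Fin n) ℤ}
    (h : (T - toC δ).det ≠ 0) : IsUnit (-T + toC δ).det := by
  have : -T + toC δ = -(T - toC δ) := by abel
  rw [this, Matrix.det_neg]
  exact isUnit_iff_ne_zero.2 (mul_ne_zero (pow_ne_zero _ (by simp)) h)

/-- The imaginary part of `T'` is invertible when that of `T` is. -/
theorem primed_im_det_ne_zero {T : Matrix (Fin n) (Fin n) ℂ} {δ : Matrix (Fin n) (Fin n) ℤ}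
    (hT : (T.map Complex.im).det ≠ 0) (h : (T - toC δ).det ≠ 0) :
    ((primed T δ).map Complex.im).det ≠ 0 := by
  have hu := det_neg_add_ne_zero h
  intro h0
  obtain ⟨v, hv, hv0⟩ := Matrix.exists_mulVec_eq_zero_iff.2 h0
  -- `T' v` is a real vector `w`, and then `v = (-T + δ) w` has imaginary part `-(Im T) w`
  set w : Fin n → ℝ := (primed T δ).map Complex.re *ᵥ v with hw
  have h1 : primed T δ *ᵥ (fun i => (v i : ℂ)) = fun i => (w i : ℂ) := by
    ext i
    have := congrFun hv0 i
    simp [Matrix.mulVec, dotProduct] at this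
    apply Complex.ext
    · simp [hw, Matrix.mulVec, dotProduct]
    · simp [Matrix.mulVec, dotProduct, this]
  have h2 : (-T + toC δ) *ᵥ (fun i => (w i : ℂ)) = fun i => (v i : ℂ) := by
    rw [← h1, primed, Matrix.mulVec_mulVec, Matrix.mul_nonsing_inv _ hu, Matrix.one_mulVec]
  have h3 : T.map Complex.im *ᵥ w = 0 := by
    ext i
    have := congrArg Complex.im (congrFun h2 i)
    simpa [Matrix.mulVec, dotProduct, toC] using this
  have h4 : w = 0 := Matrix.eq_zero_of_mulVec_eq_zero hT h3
  apply hv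
  ext i
  have := congrFun h2 i
  simp [h4, Matrix.mulVec, dotProduct] at this
  simpa using this.symm

/-- The biholomorphic map `φ(z) = (-T + δ)⁻¹ z` from the torus of `T` to the torus of `T'`; on
periods it is `(a, b) ↦ (-b, a + δ b)`. -/
noncomputable def phi (T : Matrix (Fin n) (Fin n) ℂ) (δ : Matrix (Fin n) (Fin n) ℤ)
    (h : (T - toC δ).det ≠ 0) : TorusIso T (primed T δ) where
  lin := LinearEquiv.ofLinearMap (Matrix.mulVecLin (primed T δ)) (Matrix.mulVecLin (-T + toC δ))
    (by
      rw [← Matrix.mulVecLin_mul, primed, Matrix.nonsing_inv_mul _ (det_neg_add_ne_zero h),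
        Matrix.mulVecLin_one])
    (by
      rw [← Matrix.mulVecLin_mul, primed, Matrix.mul_nonsing_inv _ (det_neg_add_ne_zero h),
        Matrix.mulVecLin_one])
  per :=
    { toFun := fun γ => (-γ.2, γ.1 + δ *ᵥ γ.2)
      invFun := fun γ => (γ.2 + δ *ᵥ γ.1, -γ.1)
      left_inv := fun γ => by simp [Matrix.mulVec_neg]
      right_inv := fun γ => by simp [Matrix.mulVec_neg]
      map_add' := fun γ γ' => by
        ext i
        · simp [add_comm]
        · simp [Matrix.mulVec_add]
          ring }
  lin_period γ := by
    have hδ : (fun i => ((γ.1 + δ *ᵥ γ.2) i : ℂ))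
        = (fun i => (γ.1 i : ℂ)) + toC δ *ᵥ (fun i => (γ.2 i : ℂ)) := by
      ext i
      simp [Matrix.mulVec, dotProduct, toC]
    have hn : (fun i => (((-γ.2) i : ℤ) : ℂ)) = -(fun i => (γ.2 i : ℂ)) := by
      ext i
      simp
    change primed T δ *ᵥ ((2 * (Real.pi : ℂ)) • _) = (2 * (Real.pi : ℂ)) • (_ + _)
    rw [Matrix.mulVec_smul]
    congr 1
    change _ = (fun i => (((-γ.2) i : ℤ) : ℂ)) + primed T δ *ᵥ (fun i => ((γ.1 + δ *ᵥ γ.2) i : ℂ))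
    rw [hδ, hn]
    have e : (fun i => (γ.1 i : ℂ)) + T *ᵥ (fun i => (γ.2 i : ℂ))
        = (fun i => (γ.1 i : ℂ)) + toC δ *ᵥ (fun i => (γ.2 i : ℂ))
          - (-T + toC δ) *ᵥ (fun i => (γ.2 i : ℂ)) := by
      rw [Matrix.add_mulVec, Matrix.neg_mulVec]
      abel
    rw [e, Matrix.mulVec_sub, Matrix.mulVec_mulVec, primed,
      Matrix.nonsing_inv_mul _ (det_neg_add_ne_zero h), Matrix.one_mulVec]
    abel

end Coordinates

/-! ### Elementary divisors and the rank `r'` -/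

/-- Invertible integer matrices `P`, `Q` with `P A Q` diagonal, the diagonal entries being
natural numbers each of which divides the next (zeros come last). -/
structure SmithForm {n : ℕ} (A : Matrix (Fin n) (Fin n) ℤ) where
  P : GL (Fin n) ℤ
  Q : GL (Fin n) ℤ
  d : Fin n → ℕ
  dvd : ∀ i j, i ≤ j → d i ∣ d j
  eq : (P : Matrix (Fin n) (Fin n) ℤ) * A * (Q : Matrix (Fin n) (Fin n) ℤ)
    = Matrix.diagonal (fun i => (d i : ℤ))

/-- `r' = ∏ rᵢ'`, where `rᵢ' = r / gcd(r, dᵢ)` is the denominator of `dᵢ / r` in lowest terms;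
zero entries contribute the factor `1`. -/
def SmithForm.rank {n : ℕ} {A : Matrix (Fin n) (Fin n) ℤ} (S : SmithForm A) (r : ℕ) : ℕ :=
  ∏ i, r / Nat.gcd r (S.d i)

section Smith

theorem smith_pivot {m : Type*} [Fintype m] [DecidableEq m] (A : Matrix m m ℤ) (hA : A ≠ 0) :
    ∃ P Q : Matrix m m ℤ, IsUnit P.det ∧ IsUnit Q.det ∧ ∃ i₀ j₀, (P * A * Q) i₀ j₀ ≠ 0 ∧
      ∀ i j, (P * A * Q) i₀ j₀ ∣ (P * A * Q) i j := by
  classical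
  let good : ℕ → Prop := fun k => 0 < k ∧ ∃ P Q : Matrix m m ℤ, IsUnit P.det ∧ IsUnit Q.det ∧
    ∃ i j, ((P * A * Q) i j).natAbs = k
  have hex : ∃ k, good k := by
    obtain ⟨i, j, hij⟩ : ∃ i j, A i j ≠ 0 := by
      by_contra! h
      exact hA (Matrix.ext h)
    exact ⟨(A i j).natAbs, Int.natAbs_pos.2 hij, 1, 1, by simp, by simp, i, j, by simp⟩
  have hmin : ∀ P Q : Matrix m m ℤ, IsUnit P.det → IsUnit Q.det → ∀ i j,
      ((P * A * Q) i j).natAbs < Nat.find hex → (P * A * Q) i j = 0 := by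
    intro P Q hP hQ i j hlt
    by_contra h
    exact Nat.find_min hex hlt ⟨Int.natAbs_pos.2 h, P, Q, hP, hQ, i, j, rfl⟩
  obtain ⟨hpos, P, Q, hP, hQ, i₀, j₀, hk⟩ := Nat.find_spec hex
  have hne : ∀ P Q : Matrix m m ℤ, ∀ i j, ((P * A * Q) i j).natAbs = Nat.find hex →
      (P * A * Q) i j ≠ 0 := by
    intro P Q i j h h0
    rw [h0] at h
    simp at h
    omega
  have hmod : ∀ x y : ℤ, y ≠ 0 → (x % y).natAbs < y.natAbs := by
    intro x y hy
    have h1 := Int.emod_nonneg x hy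
    have h2 := Int.emod_lt_abs x hy
    rw [Int.abs_eq_natAbs] at h2
    omega
  -- a minimal entry divides its column and its row
  have hcol : ∀ P Q : Matrix m m ℤ, IsUnit P.det → IsUnit Q.det → ∀ i j,
      ((P * A * Q) i j).natAbs = Nat.find hex → ∀ i', (P * A * Q) i j ∣ (P * A * Q) i' j := by
    intro P Q hP hQ i j h i'
    rcases eq_or_ne i' i with rfl | hi
    · exact dvd_rfl
    · have hd : IsUnit (Matrix.transvection i' i
          (-((P * A * Q) i' j / (P * A * Q) i j)) * P).det := by
        rw [Matrix.det_mul, Matrix.det_transvection_of_ne _ _ hi, one_mul]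
        exact hP
      have e : (Matrix.transvection i' i (-((P * A * Q) i' j / (P * A * Q) i j)) * P * A * Q) i' j
          = (P * A * Q) i' j % (P * A * Q) i j := by
        rw [Matrix.mul_assoc, Matrix.mul_assoc, ← Matrix.mul_assoc P,
          Matrix.transvection_mul_apply_same, Int.emod_def]
        ring
      have := hmin _ Q hd hQ i' j (by rw [e, ← h]; exact hmod _ _ (hne _ _ _ _ h))
      rw [e] at this
      exact Int.dvd_of_emod_eq_zero this
  have hrow : ∀ P Q : Matrix m m ℤ, IsUnit P.det → IsUnit Q.det → ∀ i j,
      ((P * A * Q) i j).natAbs = Nat.find hex → ∀ j', (P * A * Q) i j ∣ (P * A * Q) i j' := by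
    intro P Q hP hQ i j h j'
    rcases eq_or_ne j' j with rfl | hj
    · exact dvd_rfl
    · have hd : IsUnit (Q * Matrix.transvection j j'
          (-((P * A * Q) i j' / (P * A * Q) i j))).det := by
        rw [Matrix.det_mul, Matrix.det_transvection_of_ne _ _ hj.symm, mul_one]
        exact hQ
      have e : (P * A * (Q * Matrix.transvection j j' (-((P * A * Q) i j' / (P * A * Q) i j)))) i j'
          = (P * A * Q) i j' % (P * A * Q) i j := by
        rw [← Matrix.mul_assoc, Matrix.mul_transvection_apply_same, Int.emod_def]
        ring
      have := hmin P _ hP hd i j' (by rw [e, ← h]; exact hmod _ _ (hne _ _ _ _ h))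
      rw [e] at this
      exact Int.dvd_of_emod_eq_zero this
  refine ⟨P, Q, hP, hQ, i₀, j₀, hne _ _ _ _ hk, fun i j => ?_⟩
  rcases eq_or_ne i i₀ with rfl | hi
  · exact hrow P Q hP hQ _ _ hk j
  · obtain ⟨k, hk'⟩ := hcol P Q hP hQ _ _ hk i
    have hd : IsUnit (Matrix.transvection i i₀ (1 - k) * P).det := by
      rw [Matrix.det_mul, Matrix.det_transvection_of_ne _ _ hi, one_mul]
      exact hP
    have e : ∀ j, (Matrix.transvection i i₀ (1 - k) * P * A * Q) i j
        = (P * A * Q) i j + (1 - k) * (P * A * Q) i₀ j := by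
      intro j
      rw [Matrix.mul_assoc, Matrix.mul_assoc, ← Matrix.mul_assoc P,
        Matrix.transvection_mul_apply_same]
    have e1 : (Matrix.transvection i i₀ (1 - k) * P * A * Q) i j₀ = (P * A * Q) i₀ j₀ := by
      rw [e, hk']
      ring
    have h1 := hrow _ Q hd hQ i j₀ (by rw [e1, hk]) j
    rw [e1, e] at h1
    exact (dvd_add_left ((hrow P Q hP hQ _ _ hk j).mul_left _)).1 h1

/-- The block matrix with rows `(1, b)` and `(c, M)`. -/
def corner {n : ℕ} (b c : Fin n → ℤ) (M : Matrix (Fin n) (Fin n) ℤ) :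
    Matrix (Fin (n + 1)) (Fin (n + 1)) ℤ :=
  Matrix.of (Fin.cons (Fin.cons 1 b) fun i => Fin.cons (c i) (M i))

theorem det_corner_left {n : ℕ} (c : Fin n → ℤ) (M : Matrix (Fin n) (Fin n) ℤ) :
    (corner 0 c M).det = M.det := by
  rw [Matrix.det_succ_row_zero, Fin.sum_univ_succ]
  simp [corner, Matrix.submatrix]
  rfl

theorem det_corner_right {n : ℕ} (b : Fin n → ℤ) (M : Matrix (Fin n) (Fin n) ℤ) :
    (corner b 0 M).det = M.det := by
  rw [Matrix.det_succ_column_zero, Fin.sum_univ_succ]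
  simp [corner, Matrix.submatrix]
  rfl

/-- Every integer matrix has such a diagonal form. -/
theorem smith_exists (n : ℕ) (A : Matrix (Fin n) (Fin n) ℤ) :
    ∃ P Q : Matrix (Fin n) (Fin n) ℤ, IsUnit P.det ∧ IsUnit Q.det ∧ ∃ d : Fin n → ℕ,
      (∀ i j, i ≤ j → d i ∣ d j) ∧ P * A * Q = Matrix.diagonal (fun i => (d i : ℤ)) := by
  induction n with
  | zero => exact ⟨1, 1, by simp, by simp, fun _ => 0, fun i => i.elim0, Matrix.ext fun i => i.elim0⟩
  | succ n ih =>
    rcases eq_or_ne A 0 with rfl | hA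
    · exact ⟨1, 1, by simp, by simp, fun _ => 0, fun _ _ _ => dvd_rfl, by ext i j; simp [Matrix.diagonal]⟩
    obtain ⟨P, Q, hP, hQ, i₀, j₀, hne, hdvd⟩ := smith_pivot A hA
    -- move the pivot to the corner, by a permutation of the rows and of the columns
    set p := (P * A * Q) i₀ j₀ with hp
    choose C hC using hdvd
    have hC0 : C i₀ j₀ = 1 := by
      have := hC i₀ j₀
      rw [← hp] at this
      exact (mul_right_cancel₀ hne (by rw [mul_comm, ← this, one_mul]))
    let σ := Equiv.swap 0 i₀
    let π := Equiv.swap 0 j₀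
    let D : Matrix (Fin (n + 1)) (Fin (n + 1)) ℤ := Matrix.of fun i j => C (σ i) (π j)
    have hD0 : D 0 0 = 1 := by simp [D, σ, π, hC0]
    have hD : (σ.permMatrix ℤ) * (P * A * Q) * (π.permMatrix ℤ) = p • D := by
      ext i j
      simp [Equiv.Perm.permMatrix, PEquiv.toMatrix_toPEquiv_mul, PEquiv.mul_toMatrix_toPEquiv,
        D, hC, π]
    -- clear the first column and the first row
    let L := corner 0 (fun i => -D i.succ 0) 1
    let R := corner (fun j => -D 0 j.succ) 0 1
    let D' : Matrix (Fin n) (Fin n) ℤ :=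
      Matrix.of fun i j => D i.succ j.succ - D i.succ 0 * D 0 j.succ
    have hLR : L * D * R = corner 0 0 D' := by
      have h1 : L * D = corner (fun j => D 0 j.succ) 0 D' := by
        ext i j
        refine Fin.cases ?_ (fun i => ?_) i <;> refine Fin.cases ?_ (fun j => ?_) j <;>
          simp [L, corner, Matrix.mul_apply, Fin.sum_univ_succ, hD0, D', Matrix.one_apply]
        ring
      rw [h1]
      ext i j
      refine Fin.cases ?_ (fun i => ?_) i <;> refine Fin.cases ?_ (fun j => ?_) j <;>
        simp [R, corner, Matrix.mul_apply, Fin.sum_univ_succ, Matrix.one_apply]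
    obtain ⟨P', Q', hP', hQ', d, hd, hdiag⟩ := ih D'
    have hfin : corner 0 0 P' * (L * D * R) * corner 0 0 Q'
        = corner 0 0 (Matrix.diagonal fun i => (d i : ℤ)) := by
      rw [hLR, ← hdiag]
      have hmul : ∀ M M' : Matrix (Fin n) (Fin n) ℤ,
          corner 0 0 M * corner 0 0 M' = corner 0 0 (M * M') := by
        intro M M'
        ext i j
        refine Fin.cases ?_ (fun i => ?_) i <;> refine Fin.cases ?_ (fun j => ?_) j <;>
          simp [corner, Matrix.mul_apply, Fin.sum_univ_succ]
      rw [hmul, hmul]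
    have hperm : ∀ τ : Equiv.Perm (Fin (n + 1)), IsUnit (τ.permMatrix ℤ).det := by
      intro τ
      rw [Matrix.det_permutation]
      exact (Units.isUnit _)
    have hs : IsUnit p.sign := by
      rcases lt_or_gt_of_ne hne with h | h
      · simp [Int.sign_eq_neg_one_of_neg h]
      · simp [Int.sign_eq_one_of_pos h]
    refine ⟨p.sign • (corner 0 0 P' * L * σ.permMatrix ℤ * P),
      Q * π.permMatrix ℤ * R * corner 0 0 Q', ?_, ?_,
      Fin.cons p.natAbs (fun i => p.natAbs * d i), ?_, ?_⟩
    · rw [Matrix.det_smul, Matrix.det_mul, Matrix.det_mul, Matrix.det_mul, det_corner_left,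
        det_corner_left, Matrix.det_one]
      exact (hs.pow _).mul (((hP'.mul isUnit_one).mul (hperm _)).mul hP)
    · rw [Matrix.det_mul, Matrix.det_mul, Matrix.det_mul, det_corner_left,
        det_corner_right, Matrix.det_one]
      exact ((hQ.mul (hperm _)).mul isUnit_one).mul hQ'
    · intro i j
      refine Fin.cases ?_ (fun i => ?_) i <;> refine Fin.cases ?_ (fun j => ?_) j
      · simp
      · simp
      · intro h
        exact absurd h (by simp)
      · intro h
        simpa using mul_dvd_mul_left p.natAbs (hd i j (by simpa using h))
    · have e : p.sign • (corner 0 0 P' * L * σ.permMatrix ℤ * P) * A *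
          (Q * π.permMatrix ℤ * R * corner 0 0 Q')
          = (p.sign * p) • (corner 0 0 P' * (L * D * R) * corner 0 0 Q') := by
        have : corner 0 0 P' * L * σ.permMatrix ℤ * P * A * (Q * π.permMatrix ℤ * R * corner 0 0 Q')
            = corner 0 0 P' * L * ((σ.permMatrix ℤ) * (P * A * Q) * (π.permMatrix ℤ)) * R *
              corner 0 0 Q' := by
          simp only [Matrix.mul_assoc]
        rw [smul_mul_assoc, smul_mul_assoc, this, hD]
        simp only [Matrix.mul_smul, Matrix.smul_mul, smul_smul, Matrix.mul_assoc]
      rw [e, hfin, Int.sign_mul_self_eq_natAbs]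
      ext i j
      refine Fin.cases ?_ (fun i => ?_) i <;> refine Fin.cases ?_ (fun j => ?_) j <;>
        simp [corner, Matrix.diagonal_apply, (Fin.succ_ne_zero _).symm]

theorem SmithForm.nonempty {n : ℕ} (A : Matrix (Fin n) (Fin n) ℤ) : Nonempty (SmithForm A) := by
  obtain ⟨P, Q, hP, hQ, d, hd, h⟩ := smith_exists n A
  exact ⟨⟨Matrix.GeneralLinearGroup.mk'' P hP, Matrix.GeneralLinearGroup.mk'' Q hQ, d, hd, h⟩⟩

end Smith

/-! ### Products of powers -/

section Powers

variable {G : Type*} [Group G]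

/-- The ordered product `∏ⱼ gⱼ ^ aⱼ`. -/
def powProd {n : ℕ} (g : Fin n → G) (a : Fin n → ℤ) : G :=
  (List.ofFn fun j => g j ^ a j).prod

theorem prod_ofFn_mul {n : ℕ} (f g : Fin n → G) (h : ∀ i j, Commute (g i) (f j)) :
    (List.ofFn fun j => f j * g j).prod = (List.ofFn f).prod * (List.ofFn g).prod := by
  induction n with
  | zero => simp
  | succ n ih =>
    simp only [List.ofFn_succ, List.prod_cons]
    rw [ih (fun j => f j.succ) (fun j => g j.succ) (fun i j => h _ _)]
    have hc : Commute (g 0) (List.ofFn fun j : Fin n => f j.succ).prod := by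
      refine Commute.list_prod_right _ _ fun x hx => ?_
      obtain ⟨j, rfl⟩ := (List.mem_ofFn' _ _).1 hx
      exact h _ _
    simp only [mul_assoc]
    congr 1
    simp only [← mul_assoc]
    rw [hc.eq]

theorem powProd_add {n : ℕ} (g : Fin n → G) (h : ∀ i j, Commute (g i) (g j)) (a b : Fin n → ℤ) :
    powProd g (a + b) = powProd g a * powProd g b := by
  unfold powProd
  rw [← prod_ofFn_mul _ _ (fun i j => (h i j).zpow_zpow _ _)]
  simp only [Pi.add_apply, _root_.zpow_add]

theorem powProd_zero {n : ℕ} (g : Fin n → G) : powProd g 0 = 1 := by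
  simp [powProd]

theorem powProd_single {n : ℕ} (g : Fin n → G) (k : Fin n) : powProd g (Pi.single k 1) = g k := by
  have : (fun j => g j ^ (Pi.single k 1 : Fin n → ℤ) j) = Pi.mulSingle k (g k) := by
    ext j
    by_cases hj : j = k
    · subst hj; simp
    · simp [hj]
  rw [powProd, this]
  clear this
  induction n with
  | zero => exact k.elim0
  | succ n ih =>
    rw [List.ofFn_succ, List.prod_cons]
    refine Fin.cases ?_ (fun k => ?_) k
    · have : (fun i : Fin n => (Pi.mulSingle 0 (g 0) : Fin (n + 1) → G) i.succ) = fun _ => 1 := by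
        ext i
        simp
      rw [this]
      simp
    · have : (fun i : Fin n => (Pi.mulSingle k.succ (g k.succ) : Fin (n + 1) → G) i.succ)
          = Pi.mulSingle k (g k.succ) := by
        ext i
        simp [Pi.mulSingle_apply]
      rw [this, ih (fun j => g j.succ) k]
      simp

/-- If `x gⱼ x⁻¹ = cⱼ gⱼ` with `cⱼ` central, then `x g^a x⁻¹ = c^a g^a`. -/
theorem conj_powProd {n : ℕ} (g c : Fin n → G) (x : G) (hc : ∀ j y, Commute (c j) y)
    (h : ∀ j, x * g j * x⁻¹ = c j * g j) (a : Fin n → ℤ) :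
    x * powProd g a * x⁻¹ = powProd c a * powProd g a := by
  have h1 : x * powProd g a * x⁻¹ = (List.ofFn fun j => (c j * g j) ^ a j).prod := by
    rw [powProd, ← MulAut.conj_apply, map_list_prod, List.map_ofFn]
    congr 2
    ext j
    simp only [Function.comp, map_zpow, MulAut.conj_apply, h]
  rw [h1, powProd, powProd, ← prod_ofFn_mul]
  · congr 2
    ext j
    exact (hc j (g j)).mul_zpow _
  · intro i j
    exact ((hc j _).zpow_left _).symm

end Powers

section Scalars

variable {N : ℕ}

/-- The scalar unitary matrix `e^{it}`. -/
noncomputable def phase (N : ℕ) (t : ℝ) : Matrix.unitaryGroup (Fin N) ℂ :=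
  ⟨Complex.exp (t * I) • 1, by
    rw [Matrix.mem_unitaryGroup_iff, Matrix.star_eq_conjTranspose, Matrix.conjTranspose_smul,
      Matrix.conjTranspose_one, smul_mul_smul_comm, mul_one, RCLike.star_def, ← Complex.exp_conj,
      ← Complex.exp_add]
    simp⟩

theorem phase_coe (t : ℝ) :
    (phase N t : Matrix (Fin N) (Fin N) ℂ) = Complex.exp (t * I) • 1 := rfl

theorem phase_commute (t : ℝ) (x : Matrix.unitaryGroup (Fin N) ℂ) : Commute (phase N t) x := by
  apply Subtype.ext
  simp [phase_coe]

theorem phase_add (s t : ℝ) : phase N (s + t) = phase N s * phase N t := by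
  apply Subtype.ext
  rw [Submonoid.coe_mul, phase_coe, phase_coe, phase_coe, Complex.ofReal_add, add_mul,
    Complex.exp_add, smul_mul_smul_comm, mul_one]

theorem phase_zero : phase N 0 = 1 := by
  apply Subtype.ext
  simp [phase_coe]

theorem phase_zpow (t : ℝ) (m : ℤ) : phase N t ^ m = phase N (m * t) := by
  let f : Multiplicative ℝ →* Matrix.unitaryGroup (Fin N) ℂ :=
    { toFun := fun t => phase N t.toAdd
      map_one' := phase_zero
      map_mul' := fun s t => phase_add _ _ }
  have := map_zpow f (Multiplicative.ofAdd t) m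
  simpa [f, toAdd_zpow] using this.symm

theorem powProd_phase {n : ℕ} (t : Fin n → ℝ) (a : Fin n → ℤ) :
    powProd (fun j => phase N (t j)) a = phase N (∑ j, a j * t j) := by
  simp only [powProd, phase_zpow]
  induction n with
  | zero => simp [phase_zero]
  | succ n ih =>
    rw [List.ofFn_succ, List.prod_cons, Fin.sum_univ_succ, phase_add,
      ih (fun j => t j.succ) (fun j => a j.succ)]

end Scalars

/-! ### The bundles `E_{(r,A,μ,𝒰)}` -/

/-- `ζ = e^{2πi/r}`. -/
noncomputable def zetaRoot (r : ℕ) : ℂ := Complex.exp (2 * Real.pi * I / r)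

/-- Unitary matrices `V_j`, `U_k` of order `N` with the cocycle condition
`V_j V_k = V_k V_j`, `U_j U_k = U_k U_j`, `ζ^{-a_{kj}} U_k V_j = V_j U_k`. -/
@[ext]
structure SYZUnitaries {n : ℕ} (r : ℕ) (A : Matrix (Fin n) (Fin n) ℤ) (N : ℕ) where
  V : Fin n → Matrix.unitaryGroup (Fin N) ℂ
  U : Fin n → Matrix.unitaryGroup (Fin N) ℂ
  V_comm : ∀ j k, V j * V k = V k * V j
  U_comm : ∀ j k, U j * U k = U k * U j
  U_V : ∀ j k, zetaRoot r ^ (-(A k j)) • ((U k : Matrix (Fin N) (Fin N) ℂ) * (V j : Matrix _ _ ℂ))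
    = (V j : Matrix (Fin N) (Fin N) ℂ) * (U k : Matrix _ _ ℂ)

theorem SYZUnitaries.mul_pow {n r N : ℕ} {A : Matrix (Fin n) (Fin n) ℤ}
    (𝒰 : SYZUnitaries r A N) (a b : Fin n → ℤ) :
    powProd 𝒰.U b * powProd 𝒰.V a
      = phase N (2 * Real.pi / r * ∑ k, ∑ j, b k * A k j * a j)
        * (powProd 𝒰.V a * powProd 𝒰.U b) := by
  have h1 : ∀ j k, 𝒰.U k * 𝒰.V j * (𝒰.U k)⁻¹ = phase N (2 * Real.pi / r * A k j) * 𝒰.V j := by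
    intro j k
    rw [mul_inv_eq_iff_eq_mul]
    apply Subtype.ext
    have h := 𝒰.U_V j k
    have e : zetaRoot r ^ (-(A k j)) = Complex.exp (-((2 * Real.pi / r * A k j : ℝ) * I)) := by
      rw [zetaRoot, ← Complex.exp_int_mul]
      congr 1
      push_cast
      ring
    rw [e] at h
    simp only [Submonoid.coe_mul, phase_coe, smul_mul_assoc, one_mul, ← h, smul_smul,
      ← Complex.exp_add]
    simp
  have h2 : ∀ k, 𝒰.U k * powProd 𝒰.V a * (𝒰.U k)⁻¹
      = phase N (∑ j, a j * (2 * Real.pi / r * A k j)) * powProd 𝒰.V a := by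
    intro k
    rw [conj_powProd 𝒰.V _ (𝒰.U k) (fun j y => phase_commute _ y) (fun j => h1 j k) a,
      powProd_phase]
  have h3 : ∀ k, (powProd 𝒰.V a)⁻¹ * 𝒰.U k * (powProd 𝒰.V a)⁻¹⁻¹
      = phase N (∑ j, a j * (2 * Real.pi / r * A k j)) * 𝒰.U k := by
    intro k
    have := h2 k
    rw [mul_inv_eq_iff_eq_mul] at this
    rw [inv_inv, mul_assoc, this, mul_assoc, (phase_commute _ _).eq, ← mul_assoc,
      inv_mul_cancel_left, ← (phase_commute _ _).eq]
  have h4 := conj_powProd 𝒰.U _ (powProd 𝒰.V a)⁻¹ (fun j y => phase_commute _ y) h3 b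
  rw [powProd_phase, inv_inv, mul_assoc, inv_mul_eq_iff_eq_mul] at h4
  rw [h4, ← mul_assoc, ← (phase_commute _ _).eq, mul_assoc]
  congr 2
  push_cast
  rw [Finset.mul_sum]
  refine Finset.sum_congr rfl fun k _ => ?_
  rw [Finset.mul_sum, Finset.mul_sum]
  refine Finset.sum_congr rfl fun j _ => by ring

section Bundles

variable {n N : ℕ}

theorem expLin_smooth (l : (Fin n → ℂ) →ₗ[ℝ] ℂ) (k : ℂ) (M : Matrix (Fin N) (Fin N) ℂ)
    (i j : Fin N) : ContDiff ℝ ∞ (fun z => (Complex.exp (l z + k) • M) i j) := by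
  have hl : ContDiff ℝ ∞ (fun z => l z) := l.toContinuousLinearMap.contDiff
  simp only [Matrix.smul_apply, smul_eq_mul]
  exact ((hl.add contDiff_const).cexp).mul contDiff_const

theorem expLin_conn (l : (Fin n → ℂ) →ₗ[ℝ] ℂ) (k : ℂ) (M : Matrix (Fin N) (Fin N) ℂ)
    (z v : Fin n → ℂ) (c c' : ℂ) (h : l v + c' = c) (i j : Fin N) :
    fderiv ℝ (fun w => (Complex.exp (l w + k) • M) i j) z v
      + ((c' • (1 : Matrix (Fin N) (Fin N) ℂ)) * (Complex.exp (l z + k) • M)) i j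
      = ((Complex.exp (l z + k) • M) * (c • (1 : Matrix (Fin N) (Fin N) ℂ))) i j := by
  have hl : HasFDerivAt (fun w => l w) l.toContinuousLinearMap z :=
    l.toContinuousLinearMap.hasFDerivAt
  have h1 := (((hl.add_const k).cexp).mul_const (M i j)).fderiv
  simp only [Matrix.smul_apply, smul_eq_mul]
  rw [h1]
  simp [← h]
  ring

/-- The part of the exponent of the factor of automorphy that is linear in `Z`. -/
noncomputable def syzExp (τ : Matrix (Fin n) (Fin n) ℂ) (r : ℕ) (A : Matrix (Fin n) (Fin n) ℤ)
    (a : Fin n → ℤ) : (Fin n → ℂ) →ₗ[ℝ] ℂ where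
  toFun Z := I / r * ∑ j, ∑ i, (a j : ℂ) * A i j * coordY τ Z i
  map_add' Z W := by
    rw [← mul_add, ← Finset.sum_add_distrib]
    congr 1
    refine Finset.sum_congr rfl fun j _ => ?_
    rw [← Finset.sum_add_distrib]
    refine Finset.sum_congr rfl fun i _ => ?_
    simp
    ring
  map_smul' c Z := by
    simp only [map_smul, Pi.smul_apply, smul_eq_mul, Complex.real_smul, Complex.ofReal_mul,
      Finset.mul_sum, RingHom.id_apply]
    refine Finset.sum_congr rfl fun j _ => Finset.sum_congr rfl fun i _ => by ring

theorem syzExp_spec (τ : Matrix (Fin n) (Fin n) ℂ) (r : ℕ) (A : Matrix (Fin n) (Fin n) ℤ)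
    (a b : Fin n → ℤ) (Z : Fin n → ℂ) :
    I / r * ∑ j, ∑ i, (a j : ℂ) * A i j * (coordY τ Z i + 2 * Real.pi * b i)
      = syzExp τ r A a Z + I / r * ∑ j, ∑ i, (a j : ℂ) * A i j * (2 * Real.pi * b i) := by
  simp only [syzExp, LinearMap.coe_mk, AddHom.coe_mk]
  rw [← mul_add, ← Finset.sum_add_distrib]
  congr 1
  refine Finset.sum_congr rfl fun j _ => ?_
  rw [← Finset.sum_add_distrib]
  refine Finset.sum_congr rfl fun i _ => by ring

/-- The bundle `E_{(r,A,μ,𝒰)}` on the torus of `τ` with its connection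
`d - (i/2π)((1/r) Xᵗ Aᵗ + (1/r) μᵗ) dY`. Its factor of automorphy is the one determined by
`s(X + 2π e_j, Y) = e^{(i/r) a_j Y} V_j s(X, Y)` and `s(X, Y + 2π e_k) = U_k s(X, Y)`, where `a_j`
is the `j`-th column of `A`. -/
noncomputable def syzBundle (τ : Matrix (Fin n) (Fin n) ℂ) (hτ : (τ.map Complex.im).det ≠ 0)
    (r : ℕ) (A : Matrix (Fin n) (Fin n) ℤ) (μ : Fin n → ℂ) (𝒰 : SYZUnitaries r A N) :
    TorusBundle τ N where
  factor γ Z :=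
    Complex.exp (I / r * ∑ j, ∑ i, (γ.1 j : ℂ) * A i j * (coordY τ Z i + 2 * Real.pi * γ.2 i)) •
      ((powProd 𝒰.V γ.1 * powProd 𝒰.U γ.2 : Matrix.unitaryGroup (Fin N) ℂ) :
        Matrix (Fin N) (Fin N) ℂ)
  conn Z :=
    { toFun := fun v =>
        (-(I / (2 * Real.pi * r)) * ∑ i, (∑ j, (A i j : ℂ) * coordX τ Z j + μ i) * coordY τ v i) • 1
      map_add' := fun v w => by
        rw [← add_smul, ← mul_add, ← Finset.sum_add_distrib]
        simp [mul_add]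
      map_smul' := fun c v => by
        rw [RingHom.id_apply, ← smul_assoc]
        congr 1
        simp only [map_smul, Pi.smul_apply, smul_eq_mul, Complex.real_smul, Complex.ofReal_mul,
          Finset.mul_sum]
        refine Finset.sum_congr rfl fun i _ => by ring }
  factor_zero Z := by simp [powProd_zero]
  factor_add γ γ' Z := by
    have hY : ∀ i, coordY τ (Z + period τ γ') i = coordY τ Z i + 2 * Real.pi * γ'.2 i := by
      intro i
      rw [map_add, (coord_period hτ γ').2]
      rfl
    have hm : (powProd 𝒰.V (γ + γ').1 * powProd 𝒰.U (γ + γ').2 : Matrix.unitaryGroup (Fin N) ℂ)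
        = phase N (-(2 * Real.pi / r * ∑ k, ∑ j, γ.2 k * A k j * γ'.1 j)) *
          ((powProd 𝒰.V γ.1 * powProd 𝒰.U γ.2) * (powProd 𝒰.V γ'.1 * powProd 𝒰.U γ'.2)) := by
      have e : (powProd 𝒰.V γ.1 * powProd 𝒰.U γ.2) * (powProd 𝒰.V γ'.1 * powProd 𝒰.U γ'.2)
          = phase N (2 * Real.pi / r * ∑ k, ∑ j, γ.2 k * A k j * γ'.1 j) *
            (powProd 𝒰.V γ.1 * powProd 𝒰.V γ'.1 * (powProd 𝒰.U γ.2 * powProd 𝒰.U γ'.2)) := by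
        have := 𝒰.mul_pow γ'.1 γ.2
        calc _ = powProd 𝒰.V γ.1 * (powProd 𝒰.U γ.2 * powProd 𝒰.V γ'.1) * powProd 𝒰.U γ'.2 := by
              simp only [mul_assoc]
          _ = _ := by
              rw [this, ← mul_assoc (powProd 𝒰.V γ.1), ← (phase_commute _ _).eq]
              simp only [mul_assoc]
      rw [e, ← mul_assoc, ← phase_add, neg_add_cancel, phase_zero, one_mul, Prod.fst_add,
        Prod.snd_add, powProd_add _ 𝒰.V_comm, powProd_add _ 𝒰.U_comm]
    rw [hm, Submonoid.coe_mul, phase_coe, smul_mul_assoc, one_mul, smul_smul, smul_mul_smul_comm,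
      ← Submonoid.coe_mul, ← Complex.exp_add, ← Complex.exp_add]
    congr 2
    simp only [hY]
    have hs : (∑ k, ∑ j, (γ.2 k : ℂ) * A k j * γ'.1 j)
        = ∑ j, ∑ i, (γ'.1 j : ℂ) * A i j * γ.2 i := by
      rw [Finset.sum_comm]
      refine Finset.sum_congr rfl fun j _ => Finset.sum_congr rfl fun i _ => by ring
    push_cast
    rw [hs]
    have e1 : ∀ (x : ℂ), -(2 * (Real.pi : ℂ) / r * x) * I = I / r * (-(2 * Real.pi) * x) := by
      intro x; ring
    rw [e1, ← mul_add, ← mul_add]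
    congr 1
    rw [Finset.mul_sum, ← Finset.sum_add_distrib, ← Finset.sum_add_distrib]
    refine Finset.sum_congr rfl fun j _ => ?_
    rw [Finset.mul_sum, ← Finset.sum_add_distrib, ← Finset.sum_add_distrib]
    refine Finset.sum_congr rfl fun i _ => ?_
    simp
    ring
  factor_smooth γ i j := by
    simp only [syzExp_spec]
    exact expLin_smooth _ _ _ _ _
  conn_smooth v i j := by
    have hX : ∀ k, ContDiff ℝ ∞ (fun Z => (coordX τ Z k : ℂ)) := fun k =>
      Complex.ofRealCLM.contDiff.comp
        ((contDiff_apply ℝ ℝ k).comp (coordX τ).toContinuousLinearMap.contDiff)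
    simp only [LinearMap.coe_mk, AddHom.coe_mk, Matrix.smul_apply, smul_eq_mul]
    refine (contDiff_const.mul (ContDiff.sum fun k _ => ?_)).mul contDiff_const
    refine ((ContDiff.sum fun l _ => ?_).add contDiff_const).mul contDiff_const
    exact contDiff_const.mul (hX l)
  conn_factor γ Z v i j := by
    simp only [syzExp_spec, LinearMap.coe_mk, AddHom.coe_mk]
    refine expLin_conn _ _ _ _ _ _ _ ?_ i j
    have hX : ∀ k, coordX τ (Z + period τ γ) k = coordX τ Z k + 2 * Real.pi * γ.1 k := by
      intro k
      rw [map_add, (coord_period hτ γ).1]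
      rfl
    have hpi : (Real.pi : ℂ) ≠ 0 := by exact_mod_cast Real.pi_ne_zero
    simp only [hX, syzExp, LinearMap.coe_mk, AddHom.coe_mk]
    rw [Finset.sum_comm, Finset.mul_sum, Finset.mul_sum, Finset.mul_sum, ← Finset.sum_add_distrib]
    refine Finset.sum_congr rfl fun k _ => ?_
    have e : ∑ l, (A k l : ℂ) * ((coordX τ Z l + 2 * Real.pi * γ.1 l : ℝ) : ℂ)
        = ∑ l, (A k l : ℂ) * coordX τ Z l + 2 * Real.pi * ∑ l, (γ.1 l : ℂ) * A k l := by
      rw [Finset.mul_sum, ← Finset.sum_add_distrib]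
      refine Finset.sum_congr rfl fun l _ => ?_
      push_cast
      ring
    rw [e, ← Finset.sum_mul]
    have e2 : I / (2 * Real.pi * r) * (2 * Real.pi) = I / r := by
      rcases eq_or_ne (r : ℂ) 0 with h | h
      · simp [h]
      · field_simp
    rw [← e2]
    ring

/-- The transition functions in the coordinate directions. -/
theorem syzBundle_factor (τ : Matrix (Fin n) (Fin n) ℂ) (hτ : (τ.map Complex.im).det ≠ 0)
    (r : ℕ) (A : Matrix (Fin n) (Fin n) ℤ) (μ : Fin n → ℂ) (𝒰 : SYZUnitaries r A N)
    (Z : Fin n → ℂ) (k : Fin n) :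
    (syzBundle τ hτ r A μ 𝒰).factor (Pi.single k 1, 0) Z
        = Complex.exp (I / r * ∑ i, (A i k : ℂ) * coordY τ Z i) • (𝒰.V k : Matrix _ _ ℂ) ∧
      (syzBundle τ hτ r A μ 𝒰).factor (0, Pi.single k 1) Z = (𝒰.U k : Matrix _ _ ℂ) := by
  constructor
  · have : ∑ j, ∑ i, (((Pi.single k 1 : Fin n → ℤ) j : ℤ) : ℂ) * A i j *
        (coordY τ Z i + 2 * Real.pi * ((0 : Fin n → ℤ) i : ℂ))
        = ∑ i, (A i k : ℂ) * coordY τ Z i := by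
      rw [Finset.sum_eq_single k]
      · simp
      · intro j _ hj
        simp [hj]
      · simp
    simp only [syzBundle, this, powProd_single, powProd_zero, mul_one]
  · simp [syzBundle, powProd_single, powProd_zero]

end Bundles

/-! ### The bundles `ℰ_{(r,A,μ,𝒰)}` -/

section ProjectivelyFlat

variable {n N : ℕ}

/-- The entrywise complex conjugate. -/
def cbar (M : Matrix (Fin n) (Fin n) ℂ) : Matrix (Fin n) (Fin n) ℂ := M.map conj

/-- `(T - T̄)⁻¹`. -/
noncomputable def diffInv (T : Matrix (Fin n) (Fin n) ℂ) : Matrix (Fin n) (Fin n) ℂ :=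
  (T - cbar T)⁻¹

/-- `R = (i/2π)(N/r) ((T - T̄)⁻¹)ᵗ Aᵗ`. -/
noncomputable def matR (T : Matrix (Fin n) (Fin n) ℂ) (r : ℕ) (A : Matrix (Fin n) (Fin n) ℤ)
    (N : ℕ) : Matrix (Fin n) (Fin n) ℂ :=
  (I / (2 * Real.pi) * (N / r)) • ((diffInv T)ᵀ * (toC A)ᵀ)

/-- `ℛ(z, w) = ∑ R_{ij} z_i w̄_j`. -/
noncomputable def formR (T : Matrix (Fin n) (Fin n) ℂ) (r : ℕ) (A : Matrix (Fin n) (Fin n) ℤ)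
    (N : ℕ) (z w : Fin n → ℂ) : ℂ :=
  ∑ i, ∑ j, matR T r A N i j * z i * conj (w j)

/-- `j(γ, z) = U(γ) exp{(1/N) ℛ(z, γ) + (1/2N) ℛ(γ, γ)}`. -/
noncomputable def autJ (T : Matrix (Fin n) (Fin n) ℂ) (r : ℕ) (A : Matrix (Fin n) (Fin n) ℤ)
    (U : Period n → Matrix.unitaryGroup (Fin N) ℂ) (γ : Period n) (z : Fin n → ℂ) :
    Matrix (Fin N) (Fin N) ℂ :=
  Complex.exp (1 / N * formR T r A N z (period T γ)
    + 1 / (2 * N) * formR T r A N (period T γ) (period T γ)) • (U γ : Matrix (Fin N) (Fin N) ℂ)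

/-- Unitary matrices `U(γ)`, one for each lattice vector `γ`, for which `j` is a factor of
automorphy. -/
@[ext]
structure AutFactor (T : Matrix (Fin n) (Fin n) ℂ) (r : ℕ) (A : Matrix (Fin n) (Fin n) ℤ)
    (N : ℕ) where
  U : Period n → Matrix.unitaryGroup (Fin N) ℂ
  cocycle : ∀ γ γ' z,
    autJ T r A U (γ + γ') z = autJ T r A U γ (z + period T γ') * autJ T r A U γ' z

/-- Unitary matrices `U(γ_j)` (here `W j`) and `U(γ'_k)` (here `W' k`) of order `N` with
`U(γ_j) U(γ_k) = U(γ_k) U(γ_j)`,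
`U(γ'_j) U(γ'_k) = ζ^{(Aᵗδ)_{jk} - (Aᵗδ)_{kj}} U(γ'_k) U(γ'_j)` and
`ζ^{-a_{jk}} U(γ'_k) U(γ_j) = U(γ_j) U(γ'_k)`. -/
@[ext]
structure AutUnitaries (δ : Matrix (Fin n) (Fin n) ℤ) (r : ℕ) (A : Matrix (Fin n) (Fin n) ℤ)
    (N : ℕ) where
  W : Fin n → Matrix.unitaryGroup (Fin N) ℂ
  W' : Fin n → Matrix.unitaryGroup (Fin N) ℂ
  W_comm : ∀ j k, W j * W k = W k * W j
  W'_comm : ∀ j k, (W' j : Matrix (Fin N) (Fin N) ℂ) * (W' k : Matrix _ _ ℂ)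
    = zetaRoot r ^ ((Aᵀ * δ) j k - (Aᵀ * δ) k j) •
      ((W' k : Matrix (Fin N) (Fin N) ℂ) * (W' j : Matrix _ _ ℂ))
  W'_W : ∀ j k, zetaRoot r ^ (-(A j k)) •
      ((W' k : Matrix (Fin N) (Fin N) ℂ) * (W j : Matrix _ _ ℂ))
    = (W j : Matrix (Fin N) (Fin N) ℂ) * (W' k : Matrix _ _ ℂ)

/-- The values of `U` on the generators `γ_j = 2π e_j`, `γ'_k = 2π T e_k` are the given
matrices. -/
def AutFactor.Extends {T : Matrix (Fin n) (Fin n) ℂ} {δ : Matrix (Fin n) (Fin n) ℤ} {r : ℕ}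
    {A : Matrix (Fin n) (Fin n) ℤ} (ρ : AutFactor T r A N) (𝒲 : AutUnitaries δ r A N) : Prop :=
  (∀ j, ρ.U (Pi.single j 1, 0) = 𝒲.W j) ∧ ∀ k, ρ.U (0, Pi.single k 1) = 𝒲.W' k

theorem formR_add_left (T : Matrix (Fin n) (Fin n) ℂ) (r : ℕ) (A : Matrix (Fin n) (Fin n) ℤ)
    (z z' w : Fin n → ℂ) :
    formR T r A N (z + z') w = formR T r A N z w + formR T r A N z' w := by
  simp only [formR, ← Finset.sum_add_distrib]
  refine Finset.sum_congr rfl fun i _ => Finset.sum_congr rfl fun j _ => ?_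
  rw [Pi.add_apply]
  ring

theorem formR_add_right (T : Matrix (Fin n) (Fin n) ℂ) (r : ℕ) (A : Matrix (Fin n) (Fin n) ℤ)
    (z w w' : Fin n → ℂ) :
    formR T r A N z (w + w') = formR T r A N z w + formR T r A N z w' := by
  simp only [formR, ← Finset.sum_add_distrib]
  refine Finset.sum_congr rfl fun i _ => Finset.sum_congr rfl fun j _ => ?_
  rw [Pi.add_apply, map_add]
  ring

theorem formR_smul_left (T : Matrix (Fin n) (Fin n) ℂ) (r : ℕ) (A : Matrix (Fin n) (Fin n) ℤ)
    (c : ℂ) (z w : Fin n → ℂ) :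
    formR T r A N (c • z) w = c * formR T r A N z w := by
  simp only [formR, Finset.mul_sum]
  refine Finset.sum_congr rfl fun i _ => Finset.sum_congr rfl fun j _ => ?_
  rw [Pi.smul_apply, smul_eq_mul]
  ring

/-- The bundle `ℰ_{(r,A,μ,𝒰)}` on the torus of `T` with factor of automorphy `j` and connection
form `-(1/N) dzᵗ R z̄ - (i/2πr) μᵗ (δ - T̄)(T - T̄)⁻¹ dz + (i/2πr) μ̄ᵗ (δ - T̄)(T - T̄)⁻¹ dz`. -/
noncomputable def flatBundle (T : Matrix (Fin n) (Fin n) ℂ) (δ : Matrix (Fin n) (Fin n) ℤ) (r : ℕ)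
    (A : Matrix (Fin n) (Fin n) ℤ) (μ : Fin n → ℂ) (ρ : AutFactor T r A N) :
    TorusBundle T N where
  factor := autJ T r A ρ.U
  conn z :=
    { toFun := fun v =>
        (-(1 / N * formR T r A N v z)
          - I / (2 * Real.pi * r) * (μ ⬝ᵥ ((toC δ - cbar T) * diffInv T) *ᵥ v)
          + I / (2 * Real.pi * r) * (star μ ⬝ᵥ ((toC δ - cbar T) * diffInv T) *ᵥ v)) • 1
      map_add' := fun v w => by
        rw [← add_smul, formR_add_left, Matrix.mulVec_add, dotProduct_add, dotProduct_add]
        congr 1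
        ring
      map_smul' := fun c v => by
        have hc : c • v = (c : ℂ) • v := by
          ext i
          simp
        rw [RingHom.id_apply, ← smul_assoc, hc, formR_smul_left, Matrix.mulVec_smul,
          dotProduct_smul, dotProduct_smul, Complex.real_smul]
        congr 1
        simp only [smul_eq_mul]
        ring }
  factor_zero z := by
    have h : ρ.U 0 = 1 := by
      have h0 := ρ.cocycle 0 0 0
      simp only [autJ, formR, map_zero, Pi.zero_apply, add_zero, mul_zero, Finset.sum_const_zero,
        Complex.exp_zero, one_smul, ← Submonoid.coe_mul] at h0
      simpa using Subtype.ext h0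
    simp [autJ, formR, h]
  factor_add := ρ.cocycle
  factor_smooth γ i j := by
    let l : (Fin n → ℂ) →ₗ[ℝ] ℂ :=
      { toFun := fun z => 1 / N * formR T r A N z (period T γ)
        map_add' := fun z w => by rw [formR_add_left, mul_add]
        map_smul' := fun c z => by
          have hc : c • z = (c : ℂ) • z := by
            ext i
            simp
          rw [hc, formR_smul_left, RingHom.id_apply, Complex.real_smul]
          ring }
    exact expLin_smooth l _ _ i j
  conn_smooth v i j := by
    simp only [LinearMap.coe_mk, AddHom.coe_mk, Matrix.smul_apply, smul_eq_mul]
    refine (ContDiff.add (ContDiff.sub (contDiff_const.mul ?_).neg contDiff_const)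
      contDiff_const).mul contDiff_const
    unfold formR
    refine ContDiff.sum fun k _ => ContDiff.sum fun m _ => contDiff_const.mul ?_
    exact Complex.conjCLE.contDiff.comp (contDiff_apply ℝ ℂ m)
  conn_factor γ z v i j := by
    let l : (Fin n → ℂ) →ₗ[ℝ] ℂ :=
      { toFun := fun z => 1 / N * formR T r A N z (period T γ)
        map_add' := fun z w => by rw [formR_add_left, mul_add]
        map_smul' := fun c z => by
          have hc : c • z = (c : ℂ) • z := by
            ext i
            simp
          rw [hc, formR_smul_left, RingHom.id_apply, Complex.real_smul]
          ring }
    refine expLin_conn l _ _ z v _ _ ?_ i j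
    simp only [l, LinearMap.coe_mk, AddHom.coe_mk, formR_add_right]
    ring

/-- `𝒜 = (N/r) ((T - T̄)⁻¹)ᵗ Aᵗ (δ - T) (T - T̄)⁻¹`. -/
noncomputable def calA (T : Matrix (Fin n) (Fin n) ℂ) (δ : Matrix (Fin n) (Fin n) ℤ) (r : ℕ)
    (A : Matrix (Fin n) (Fin n) ℤ) (N : ℕ) : Matrix (Fin n) (Fin n) ℂ :=
  ((N : ℂ) / r) • ((diffInv T)ᵀ * (toC A)ᵀ * (toC δ - T) * diffInv T)

/-- The scalar factor of `Ψ(z, z̄)`. -/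
noncomputable def psi (T : Matrix (Fin n) (Fin n) ℂ) (δ : Matrix (Fin n) (Fin n) ℤ) (r : ℕ)
    (A : Matrix (Fin n) (Fin n) ℤ) (μ : Fin n → ℂ) (N : ℕ) (z : Fin n → ℂ) : ℂ :=
  Complex.exp (
    I / (4 * Real.pi * N) * (z ⬝ᵥ cbar (calA T δ r A N) *ᵥ z)
    + I / (4 * Real.pi * N) * (star z ⬝ᵥ calA T δ r A N *ᵥ star z)
    - I / (2 * Real.pi * N) * (z ⬝ᵥ calA T δ r A N *ᵥ star z)
    + I / (2 * Real.pi * r) * (star z ⬝ᵥ ((diffInv T)ᵀ * (toC δ - T)ᵀ) *ᵥ μ)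
    - I / (2 * Real.pi * r) * (z ⬝ᵥ ((diffInv T)ᵀ * (toC δ - cbar T)ᵀ) *ᵥ star μ))

end ProjectivelyFlat

/-- If `xᵗ (Im T) x > 0` for all real `x ≠ 0`, then `Im T` is invertible. -/
theorem im_det_ne_zero {n : ℕ} {T : Matrix (Fin n) (Fin n) ℂ}
    (hT : ∀ x : Fin n → ℝ, x ≠ 0 → 0 < x ⬝ᵥ T.map Complex.im *ᵥ x) :
    (T.map Complex.im).det ≠ 0 := by
  intro h
  obtain ⟨v, hv, h0⟩ := Matrix.exists_mulVec_eq_zero_iff.2 h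
  have := hT v hv
  rw [h0, dotProduct_zero] at this
  exact lt_irrefl _ this

/-- The pullback bundle `φ^*E_{(r,A,μ,𝒰)}` on the torus of `T`, where `E_{(r,A,μ,𝒰)}` is the bundle
on the torus of `T' = (-T + δ)⁻¹`. -/
noncomputable def pulledBundle {n N : ℕ} (T : Matrix (Fin n) (Fin n) ℂ)
    (hT : (T.map Complex.im).det ≠ 0) (δ : Matrix (Fin n) (Fin n) ℤ) (hδ : (T - toC δ).det ≠ 0)
    (r : ℕ) (A : Matrix (Fin n) (Fin n) ℤ) (μ : Fin n → ℂ) (𝒰 : SYZUnitaries r A N) :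
    TorusBundle T N :=
  (syzBundle (primed T δ) (primed_im_det_ne_zero hT hδ) r A μ 𝒰).pullback (phi T δ hδ)

/-! ### Conjugation, the symmetric matrix `redA`, and the real coordinates of `φ(z)`. -/

section ConjugateAlgebra

variable {n : ℕ}

/-! Put D = (T - T̄)⁻¹ and S = DᵗAᵗ(δ - T)D (`redA`). Because D̄ = -D, one has S̄ = DᵗAᵗ(δ - T̄)D
and S̄ - S = DᵗAᵗ, and the symmetry of AT' makes S symmetric. So R is a multiple of S̄ - S and 𝒜 of
S. As X = -D(z - z̄) at φ(z), the connection form of φ^*E is also an expression in S, S̄ and μ. From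
here on the analytic part is bilinear algebra with one symmetric matrix.

Connections: both connection forms are scalar, and log Ψ is a quadratic polynomial in z, z̄ whose
differential is their difference (`fderiv_psi_add_flatForm`); this is the identity ∇̃Ψ = Ψ φ^*∇. The
form of ℰ has type (1,0), so its holomorphic sections are ordinary holomorphic maps, and s is
holomorphic for φ^*E exactly when Ψs is holomorphic. The (0,2)-curvature of φ^*E is the
antisymmetrisation of S and vanishes.

Factors of automorphy: conjugating the factor of φ^*E by the scalar Ψ gives a cocycle automatically.
Its dependence on z is exactly exp(ℛ(z,γ)/r'), and the remaining constant is a unitary matrix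
because a certain phase is real (`psi_smul_autJ`, `gaugeAngle_real`). Hence every family 𝒰 produces
a map U on the lattice without any direct construction.

Correspondence: the cocycle condition at z = 0 says that U is a projective representation of the
lattice (`AutFactor.U_add`). So U is determined by its generators, and its commutators are powers of
ζ (`formR_sub_swap`), which gives the relations in (b). Since φ takes γ_j to 2πT'e_j and γ'_k to
2π(-e_k + T'δe_k), up to phases U(γ_j) = U_j and U(γ'_k) = V_k⁻¹ ∏ U_l^{δ_lk}. These equations can
be solved for U_j and V_k, and the relations (b) turn into the relations (a). The resulting
bijection also supplies the existence half of the extension statement. -/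

theorem cbar_mul (M M' : Matrix (Fin n) (Fin n) ℂ) : cbar (M * M') = cbar M * cbar M' :=
  Matrix.map_mul (f := starRingEnd ℂ)

theorem cbar_cbar (M : Matrix (Fin n) (Fin n) ℂ) : cbar (cbar M) = M := by
  ext i j
  simp [cbar]

theorem cbar_sub (M M' : Matrix (Fin n) (Fin n) ℂ) : cbar (M - M') = cbar M - cbar M' := by
  ext i j
  simp [cbar]

theorem cbar_transpose (M : Matrix (Fin n) (Fin n) ℂ) : cbar Mᵀ = (cbar M)ᵀ := rfl

theorem cbar_toC (M : Matrix (Fin n) (Fin n) ℤ) : cbar (toC M) = toC M := by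
  ext i j
  simp [cbar, toC]

theorem star_mulVec_cbar (M : Matrix (Fin n) (Fin n) ℂ) (z : Fin n → ℂ) :
    star (M *ᵥ z) = cbar M *ᵥ star z := by
  ext i
  simp [Matrix.mulVec, dotProduct, cbar]

theorem star_dotProduct_star' (z w : Fin n → ℂ) : conj (z ⬝ᵥ w) = star z ⬝ᵥ star w := by
  simp [dotProduct]

theorem dotProduct_mulVec_comm {M : Matrix (Fin n) (Fin n) ℂ} (hM : Mᵀ = M) (z w : Fin n → ℂ) :
    z ⬝ᵥ M *ᵥ w = w ⬝ᵥ M *ᵥ z := by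
  rw [Matrix.dotProduct_mulVec, ← Matrix.mulVec_transpose, hM, dotProduct_comm]

/-- T - T̄ is 2i times the imaginary part of T. -/
theorem sub_cbar_det_ne_zero {T : Matrix (Fin n) (Fin n) ℂ} (hT : (T.map Complex.im).det ≠ 0) :
    (T - cbar T).det ≠ 0 := by
  have h : T - cbar T = (2 * I) • (T.map Complex.im).map Complex.ofRealHom := by
    ext i j
    simp [cbar, Complex.sub_conj]
    ring
  rw [h, Matrix.det_smul, ← RingHom.mapMatrix_apply, ← RingHom.map_det]
  exact mul_ne_zero (pow_ne_zero _ (by simp)) (by simpa using hT)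

theorem diffInv_mul {T : Matrix (Fin n) (Fin n) ℂ} (hT : (T.map Complex.im).det ≠ 0) :
    diffInv T * (T - cbar T) = 1 :=
  Matrix.nonsing_inv_mul _ (isUnit_iff_ne_zero.2 (sub_cbar_det_ne_zero hT))

theorem mul_diffInv {T : Matrix (Fin n) (Fin n) ℂ} (hT : (T.map Complex.im).det ≠ 0) :
    (T - cbar T) * diffInv T = 1 :=
  Matrix.mul_nonsing_inv _ (isUnit_iff_ne_zero.2 (sub_cbar_det_ne_zero hT))

theorem cbar_diffInv {T : Matrix (Fin n) (Fin n) ℂ} (hT : (T.map Complex.im).det ≠ 0) :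
    cbar (diffInv T) = -diffInv T := by
  have h : cbar (diffInv T) * (T - cbar T) = -1 := by
    have := congrArg cbar (diffInv_mul hT)
    rw [cbar_mul, cbar_sub, cbar_cbar, ← neg_sub T, mul_neg] at this
    rw [← neg_eq_iff_eq_neg, this]
    ext i j
    simp [cbar, Matrix.one_apply]
  calc cbar (diffInv T) = cbar (diffInv T) * (T - cbar T) * diffInv T := by
        rw [Matrix.mul_assoc, mul_diffInv hT, Matrix.mul_one]
    _ = _ := by rw [h, neg_mul, Matrix.one_mul]

theorem primed_mul {T : Matrix (Fin n) (Fin n) ℂ} {δ : Matrix (Fin n) (Fin n) ℤ}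
    (h : (T - toC δ).det ≠ 0) : primed T δ * (toC δ - T) = 1 := by
  rw [primed, sub_eq_neg_add, Matrix.nonsing_inv_mul _ (det_neg_add_ne_zero h)]

theorem mul_primed {T : Matrix (Fin n) (Fin n) ℂ} {δ : Matrix (Fin n) (Fin n) ℤ}
    (h : (T - toC δ).det ≠ 0) : (toC δ - T) * primed T δ = 1 := by
  rw [primed, sub_eq_neg_add, Matrix.mul_nonsing_inv _ (det_neg_add_ne_zero h)]

/-- Congruence preserves symmetry, and (δ - T)ᵗ(AT')(δ - T) = (δ - T)ᵗA because T'(δ - T) = 1. -/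
theorem transpose_mul_symm {T : Matrix (Fin n) (Fin n) ℂ} {δ A : Matrix (Fin n) (Fin n) ℤ}
    (h : (T - toC δ).det ≠ 0) (hA : (toC A * primed T δ)ᵀ = toC A * primed T δ) :
    ((toC A)ᵀ * (toC δ - T))ᵀ = (toC A)ᵀ * (toC δ - T) := by
  have h1 := congrArg (fun M => (toC δ - T)ᵀ * M * (toC δ - T)) hA
  simp only [← Matrix.transpose_mul] at h1
  rw [Matrix.mul_assoc (toC A), primed_mul h, Matrix.mul_one, Matrix.mul_assoc (toC δ - T)ᵀ,
    Matrix.mul_assoc (toC A), primed_mul h, Matrix.mul_one] at h1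
  rw [Matrix.transpose_mul, Matrix.transpose_transpose, h1]

/-- `((T - T̄)⁻¹)ᵗ Aᵗ (δ - T) (T - T̄)⁻¹`. -/
noncomputable def redA (T : Matrix (Fin n) (Fin n) ℂ) (δ A : Matrix (Fin n) (Fin n) ℤ) :
    Matrix (Fin n) (Fin n) ℂ :=
  (diffInv T)ᵀ * (toC A)ᵀ * (toC δ - T) * diffInv T

theorem redA_transpose {T : Matrix (Fin n) (Fin n) ℂ} {δ A : Matrix (Fin n) (Fin n) ℤ}
    (h : (T - toC δ).det ≠ 0) (hA : (toC A * primed T δ)ᵀ = toC A * primed T δ) :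
    (redA T δ A)ᵀ = redA T δ A := by
  rw [redA, Matrix.mul_assoc (diffInv T)ᵀ, Matrix.transpose_mul, Matrix.transpose_mul,
    transpose_mul_symm h hA, Matrix.transpose_transpose, Matrix.mul_assoc, Matrix.mul_assoc,
    Matrix.mul_assoc]

theorem cbar_redA {T : Matrix (Fin n) (Fin n) ℂ} (hT : (T.map Complex.im).det ≠ 0)
    (δ A : Matrix (Fin n) (Fin n) ℤ) :
    cbar (redA T δ A) = (diffInv T)ᵀ * (toC A)ᵀ * (toC δ - cbar T) * diffInv T := by
  simp only [redA, cbar_mul, cbar_transpose, cbar_diffInv hT, cbar_toC, cbar_sub]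
  simp

/-- The two matrices differ only in the middle factor, where (δ - T̄) - (δ - T) = T - T̄ cancels
against D. This is what expresses R through S and S̄. -/
theorem cbar_redA_sub {T : Matrix (Fin n) (Fin n) ℂ} (hT : (T.map Complex.im).det ≠ 0)
    (δ A : Matrix (Fin n) (Fin n) ℤ) :
    (diffInv T)ᵀ * (toC A)ᵀ = cbar (redA T δ A) - redA T δ A := by
  rw [cbar_redA hT, redA, ← Matrix.sub_mul, ← Matrix.mul_sub, sub_sub_sub_cancel_left,
    Matrix.mul_assoc, mul_diffInv hT, Matrix.mul_one]

theorem cbar_redA_transpose {T : Matrix (Fin n) (Fin n) ℂ} {δ A : Matrix (Fin n) (Fin n) ℤ}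
    (h : (T - toC δ).det ≠ 0) (hA : (toC A * primed T δ)ᵀ = toC A * primed T δ) :
    (cbar (redA T δ A))ᵀ = cbar (redA T δ A) := by
  rw [← cbar_transpose, redA_transpose h hA]

/-- The real coordinates of `φ(z)` satisfy `(δ - T) X + Y = z`. -/
theorem coord_primed {T : Matrix (Fin n) (Fin n) ℂ} {δ : Matrix (Fin n) (Fin n) ℤ}
    (hT : (T.map Complex.im).det ≠ 0) (h : (T - toC δ).det ≠ 0) (z : Fin n → ℂ) :
    (toC δ - T) *ᵥ (fun i => (coordX (primed T δ) (primed T δ *ᵥ z) i : ℂ))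
      + (fun i => (coordY (primed T δ) (primed T δ *ᵥ z) i : ℂ)) = z := by
  have h1 := (coord_spec (primed_im_det_ne_zero hT h) (primed T δ *ᵥ z) _ _).2 ⟨rfl, rfl⟩
  have h2 := congrArg (fun v => (toC δ - T) *ᵥ v) h1
  simpa only [Matrix.mulVec_add, Matrix.mulVec_mulVec, mul_primed h, Matrix.one_mulVec] using h2

theorem coordX_primed {T : Matrix (Fin n) (Fin n) ℂ} {δ : Matrix (Fin n) (Fin n) ℤ}
    (hT : (T.map Complex.im).det ≠ 0) (h : (T - toC δ).det ≠ 0) (z : Fin n → ℂ) :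
    (fun i => (coordX (primed T δ) (primed T δ *ᵥ z) i : ℂ)) = -(diffInv T *ᵥ (z - star z)) := by
  have h1 := coord_primed hT h z
  have h2 := congrArg star h1
  have hs : ∀ x : Fin n → ℝ, star (fun i => (x i : ℂ)) = fun i => (x i : ℂ) := fun x => by
    ext i
    simp
  rw [star_add, star_mulVec_cbar, hs, hs, cbar_sub, cbar_toC] at h2
  -- X and Y are real, so subtracting the conjugate of (δ - T)X + Y = z removes Y and leaves -(T -
  -- T̄)X = z - z̄.
  have h3 := congrArg₂ (fun a b => diffInv T *ᵥ (a - b)) h1 h2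
  simp only [add_sub_add_right_eq_sub] at h3
  rw [← Matrix.sub_mulVec, sub_sub_sub_cancel_left, ← neg_sub T, Matrix.neg_mulVec,
    Matrix.mulVec_neg, Matrix.mulVec_mulVec, diffInv_mul hT, Matrix.one_mulVec] at h3
  rw [← h3, neg_neg]

theorem coordY_primed {T : Matrix (Fin n) (Fin n) ℂ} {δ : Matrix (Fin n) (Fin n) ℤ}
    (hT : (T.map Complex.im).det ≠ 0) (h : (T - toC δ).det ≠ 0) (z : Fin n → ℂ) :
    (fun i => (coordY (primed T δ) (primed T δ *ᵥ z) i : ℂ))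
      = ((toC δ - cbar T) * diffInv T) *ᵥ z - ((toC δ - T) * diffInv T) *ᵥ star z := by
  have h1 := coord_primed hT h z
  rw [coordX_primed hT h, ← eq_sub_iff_add_eq'] at h1
  have h2 : (toC δ - cbar T) * diffInv T = 1 + (toC δ - T) * diffInv T := by
    rw [← mul_diffInv hT, ← Matrix.add_mul]
    congr 1
    abel
  rw [h1, h2, Matrix.mulVec_neg, Matrix.mulVec_mulVec, Matrix.mulVec_sub, Matrix.add_mulVec,
    Matrix.one_mulVec]
  abel

end ConjugateAlgebra

/-! ### The exponent of Ψ and the form ℛ in terms of `redA`. -/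

section Exponent

variable {n N : ℕ}

/-- The exponent of `Ψ`, divided by `i / 2πr`. -/
noncomputable def psiExp (T : Matrix (Fin n) (Fin n) ℂ) (δ A : Matrix (Fin n) (Fin n) ℤ)
    (μ : Fin n → ℂ) (z : Fin n → ℂ) : ℂ :=
  1 / 2 * (z ⬝ᵥ cbar (redA T δ A) *ᵥ z) + 1 / 2 * (star z ⬝ᵥ redA T δ A *ᵥ star z)
    - z ⬝ᵥ redA T δ A *ᵥ star z
    + μ ⬝ᵥ ((toC δ - T) * diffInv T) *ᵥ star z
    - star μ ⬝ᵥ ((toC δ - cbar T) * diffInv T) *ᵥ z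

theorem calA_eq (T : Matrix (Fin n) (Fin n) ℂ) (δ : Matrix (Fin n) (Fin n) ℤ) (r : ℕ)
    (A : Matrix (Fin n) (Fin n) ℤ) : calA T δ r A N = ((N : ℂ) / r) • redA T δ A := rfl

theorem cbar_calA (T : Matrix (Fin n) (Fin n) ℂ) (δ : Matrix (Fin n) (Fin n) ℤ) (r : ℕ)
    (A : Matrix (Fin n) (Fin n) ℤ) :
    cbar (calA T δ r A N) = ((N : ℂ) / r) • cbar (redA T δ A) := by
  rw [calA_eq]
  ext i j
  simp [cbar]

/-- The factor N in 𝒜 cancels the 1/N in the exponent, so that Ψ depends on r alone; the same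
happens to ℛ/N in `formR_eq`. -/
theorem psi_eq (hN : N ≠ 0) (T : Matrix (Fin n) (Fin n) ℂ) (δ : Matrix (Fin n) (Fin n) ℤ) (r : ℕ)
    (A : Matrix (Fin n) (Fin n) ℤ) (μ : Fin n → ℂ) (z : Fin n → ℂ) :
    psi T δ r A μ N z = Complex.exp (I / (2 * Real.pi * r) * psiExp T δ A μ z) := by
  have hN' : (N : ℂ) ≠ 0 := Nat.cast_ne_zero.2 hN
  have ht : ∀ (M M' : Matrix (Fin n) (Fin n) ℂ) (x y : Fin n → ℂ),
      x ⬝ᵥ (Mᵀ * M'ᵀ) *ᵥ y = y ⬝ᵥ (M' * M) *ᵥ x := by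
    intro M M' x y
    rw [← Matrix.transpose_mul, Matrix.mulVec_transpose, dotProduct_comm, Matrix.dotProduct_mulVec]
  rw [psi, psiExp, cbar_calA, calA_eq, ht, ht]
  simp only [Matrix.smul_mulVec, dotProduct_smul, smul_eq_mul]
  congr 1
  field_simp
  ring

theorem formR_eq (hN : N ≠ 0) {T : Matrix (Fin n) (Fin n) ℂ} (hT : (T.map Complex.im).det ≠ 0)
    (δ : Matrix (Fin n) (Fin n) ℤ) (r : ℕ) (A : Matrix (Fin n) (Fin n) ℤ) (z w : Fin n → ℂ) :
    1 / N * formR T r A N z w = I / (2 * Real.pi * r) *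
      (z ⬝ᵥ cbar (redA T δ A) *ᵥ star w - z ⬝ᵥ redA T δ A *ᵥ star w) := by
  have hN' : (N : ℂ) ≠ 0 := Nat.cast_ne_zero.2 hN
  rw [← dotProduct_sub, ← Matrix.sub_mulVec, ← cbar_redA_sub hT δ A]
  have h1 : formR T r A N z w = z ⬝ᵥ matR T r A N *ᵥ star w := by
    simp only [formR, dotProduct, Matrix.mulVec, Finset.mul_sum]
    refine Finset.sum_congr rfl fun i _ => Finset.sum_congr rfl fun j _ => ?_
    simp
    ring
  rw [h1, matR, Matrix.smul_mulVec, dotProduct_smul, smul_eq_mul]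
  field_simp

end Exponent

/-! ### Differentiating quadratic functions over the reals. -/

section Calculus

variable {n : ℕ}

/-- The directional derivative is the linear coefficient along the real line through z. This reduces
every derivative of a quadratic expression in z and z̄ to an algebraic expansion. -/
theorem fderiv_eq_of_line_quadratic {f : (Fin n → ℂ) → ℂ} {z u : Fin n → ℂ} {a b : ℂ}
    (hf : DifferentiableAt ℝ f z) (h : ∀ t : ℝ, f (z + t • u) = f z + t * a + (t : ℂ) ^ 2 * b) :
    fderiv ℝ f z u = a := by
  rw [← hf.lineDeriv_eq_fderiv]
  refine HasLineDerivAt.lineDeriv ?_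
  unfold HasLineDerivAt
  simp only [h]
  have h1 : HasDerivAt (fun t : ℝ => (t : ℂ)) 1 0 := Complex.ofRealCLM.hasDerivAt
  have := ((h1.mul_const a).const_add (f z)).add ((h1.pow 2).mul_const b)
  simpa using! this

theorem contDiff_dotProduct_mulVec (M : Matrix (Fin n) (Fin n) ℂ)
    {f g : (Fin n → ℂ) → (Fin n → ℂ)} (hf : ContDiff ℝ ∞ f) (hg : ContDiff ℝ ∞ g) :
    ContDiff ℝ ∞ (fun z => f z ⬝ᵥ M *ᵥ g z) := by
  simp only [dotProduct, Matrix.mulVec]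
  exact ContDiff.sum fun i _ => (contDiff_pi.1 hf i).mul
    (ContDiff.sum fun j _ => contDiff_const.mul (contDiff_pi.1 hg j))

theorem contDiff_star_pi : ContDiff ℝ ∞ (fun z : Fin n → ℂ => star z) :=
  contDiff_pi.2 fun i => Complex.conjCLE.contDiff.comp (contDiff_apply ℝ ℂ i)

theorem star_I_smul (v : Fin n → ℂ) : star (I • v) = -(I • star v) := by
  ext i
  simp

theorem star_real_smul (t : ℝ) (v : Fin n → ℂ) : star ((t : ℂ) • v) = (t : ℂ) • star v := by
  ext i
  simp

theorem real_smul_pi (t : ℝ) (v : Fin n → ℂ) : t • v = (t : ℂ) • v := by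
  ext i
  simp

end Calculus

/-! ### Scalar connections and scalar gauge transformations. -/

namespace TorusBundle

variable {n N : ℕ} {τ : Matrix (Fin n) (Fin n) ℂ}

/-- Scalar matrices commute, so the term ω ∧ ω drops out and only dω remains. -/
theorem curvature_of_scalar (B : TorusBundle τ N) (c : (Fin n → ℂ) → (Fin n → ℂ) → ℂ)
    (hc : ∀ z v, B.conn z v = c z v • 1) (z u v : Fin n → ℂ) :
    B.curvature z u v
      = (fderiv ℝ (fun w => c w v) z u - fderiv ℝ (fun w => c w u) z v) • 1 := by
  ext i j
  simp only [curvature, hc, Matrix.add_apply, Matrix.of_apply, Matrix.smul_apply,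
    smul_mul_smul_comm, mul_comm (c z v), sub_self]
  rcases eq_or_ne i j with rfl | hij
  · simp
  · simp [Matrix.one_apply_ne hij]

/-- Two bundles whose data are related by a nowhere vanishing scalar function are isomorphic. -/
noncomputable def isoOfScalar (B C : TorusBundle τ N) (g : (Fin n → ℂ) → ℂ) (hg : ∀ z, g z ≠ 0)
    (hs : ContDiff ℝ ∞ g)
    (hf : ∀ γ z, g z • C.factor γ z = g (z + period τ γ) • B.factor γ z)
    (hp : ∀ z v i j, fderiv ℝ (fun w => (g w • (1 : Matrix (Fin N) (Fin N) ℂ)) i j) z v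
      + (C.conn z v * (g z • 1)) i j = ((g z • 1) * B.conn z v) i j) : Iso B C where
  toHomeomorph :=
    { toFun := Quotient.map (fun p => (p.1, g p.1 • p.2)) (by
        rintro p q ⟨γ, rfl⟩
        refine ⟨γ, Prod.ext rfl ?_⟩
        simp only [Matrix.mulVec_smul, ← Matrix.smul_mulVec, hf])
      invFun := Quotient.map (fun p => (p.1, (g p.1)⁻¹ • p.2)) (by
        rintro p q ⟨γ, rfl⟩
        refine ⟨γ, Prod.ext rfl ?_⟩
        simp only [Matrix.mulVec_smul]
        rw [inv_smul_eq_iff₀ (hg _), smul_comm, ← Matrix.smul_mulVec, ← hf, Matrix.smul_mulVec,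
          inv_smul_smul₀ (hg _)])
      left_inv := by
        rintro ⟨z, v⟩
        exact congrArg (Quotient.mk B.setoid) (Prod.ext rfl (inv_smul_smul₀ (hg z) v))
      right_inv := by
        rintro ⟨z, v⟩
        exact congrArg (Quotient.mk C.setoid) (Prod.ext rfl (smul_inv_smul₀ (hg z) v))
      continuous_toFun := Continuous.quotient_map'
        (continuous_fst.prodMk ((hs.continuous.comp continuous_fst).smul continuous_snd)) _
      continuous_invFun := Continuous.quotient_map'
        (continuous_fst.prodMk
          (((hs.continuous.comp continuous_fst).inv₀ fun _ => hg _).smul continuous_snd)) _ }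
  proj_comp := by
    rintro ⟨z, v⟩
    rfl
  lift z := g z • 1
  lift_smooth i j := by
    simp only [Matrix.smul_apply, smul_eq_mul]
    exact hs.mul contDiff_const
  map_mk z v := by
    rw [Matrix.smul_mulVec, Matrix.one_mulVec]
    rfl
  parallel := hp

end TorusBundle

/-! ### The Cauchy-Riemann equations for maps between complex normed spaces. -/

theorem smul_eq_re_smul_add_im_smul {E : Type*} [AddCommGroup E] [Module ℂ E] (c : ℂ) (w : E) :
    c • w = c.re • w + c.im • I • w := by
  rw [← Complex.coe_smul, ← Complex.coe_smul, smul_smul, ← add_smul, Complex.re_add_im]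

/-- A real derivative that commutes with multiplication by i is complex linear. The condition is
written in the form taken by `TorusBundle.dbar`. -/
theorem differentiableAt_complex_iff_fderiv_smul_I {E F : Type*} [NormedAddCommGroup E]
    [NormedSpace ℂ E] [NormedAddCommGroup F] [NormedSpace ℂ F] {f : E → F} {z : E}
    (hf : DifferentiableAt ℝ f z) :
    DifferentiableAt ℂ f z ↔ ∀ v, fderiv ℝ f z v + I • fderiv ℝ f z (I • v) = 0 := by
  constructor
  · intro h v
    rw [h.fderiv_restrictScalars ℝ]
    simp [smul_smul]
  · intro h
    have hI : ∀ v, fderiv ℝ f z (I • v) = I • fderiv ℝ f z v := fun v => by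
      have := congrArg (fun w => I • w) (h v)
      simp only [smul_add, smul_smul, I_mul_I, smul_zero, neg_one_smul] at this
      exact (add_neg_eq_zero.1 this).symm
    refine (differentiableAt_iff_restrictScalars ℝ hf).2 ⟨
      { toFun := fderiv ℝ f z
        map_add' := map_add _
        map_smul' := fun c v => ?_
        cont := (fderiv ℝ f z).cont }, rfl⟩
    rw [RingHom.id_apply, smul_eq_re_smul_add_im_smul c v, map_add, map_smul, map_smul, hI,
      ← smul_eq_re_smul_add_im_smul]

/-! ### The two connection forms, and Ψ as the gauge transformation between them. -/

section Connections

variable {n N : ℕ}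

/-- The cross term `(d/dt) (psiExp (z + t v))` for `t = 0`, without the part linear in `v`. -/
noncomputable def psiCross (T : Matrix (Fin n) (Fin n) ℂ) (δ A : Matrix (Fin n) (Fin n) ℤ)
    (z v : Fin n → ℂ) : ℂ :=
  z ⬝ᵥ cbar (redA T δ A) *ᵥ v + star z ⬝ᵥ redA T δ A *ᵥ star v
    - z ⬝ᵥ redA T δ A *ᵥ star v - v ⬝ᵥ redA T δ A *ᵥ star z

theorem psiExp_add {T : Matrix (Fin n) (Fin n) ℂ} {δ A : Matrix (Fin n) (Fin n) ℤ}
    (h : (T - toC δ).det ≠ 0) (hA : (toC A * primed T δ)ᵀ = toC A * primed T δ)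
    (μ : Fin n → ℂ) (z v : Fin n → ℂ) :
    psiExp T δ A μ (z + v) = psiExp T δ A μ z + psiExp T δ A μ v + psiCross T δ A z v := by
  -- Symmetry of S and S̄ merges the two mixed terms of each pure quadratic form, which absorbs the
  -- coefficient 1/2. The mixed form in z and z̄ keeps both of its terms.
  have h1 := dotProduct_mulVec_comm (cbar_redA_transpose h hA) v z
  have h2 := dotProduct_mulVec_comm (redA_transpose h hA) (star v) (star z)
  simp only [psiExp, psiCross, star_add, Matrix.mulVec_add, dotProduct_add, add_dotProduct]
  linear_combination (1 / 2) * h1 + (1 / 2) * h2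

theorem psiExp_line {T : Matrix (Fin n) (Fin n) ℂ} {δ A : Matrix (Fin n) (Fin n) ℤ}
    (h : (T - toC δ).det ≠ 0) (hA : (toC A * primed T δ)ᵀ = toC A * primed T δ)
    (μ : Fin n → ℂ) (z v : Fin n → ℂ) (t : ℝ) :
    psiExp T δ A μ (z + t • v) = psiExp T δ A μ z
      + t * (psiCross T δ A z v + μ ⬝ᵥ ((toC δ - T) * diffInv T) *ᵥ star v
        - star μ ⬝ᵥ ((toC δ - cbar T) * diffInv T) *ᵥ v)
      + (t : ℂ) ^ 2 * (1 / 2 * (v ⬝ᵥ cbar (redA T δ A) *ᵥ v)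
        + 1 / 2 * (star v ⬝ᵥ redA T δ A *ᵥ star v) - v ⬝ᵥ redA T δ A *ᵥ star v) := by
  rw [psiExp_add h hA, real_smul_pi]
  simp only [psiExp, psiCross, star_real_smul, Matrix.mulVec_smul, dotProduct_smul, smul_dotProduct,
    smul_eq_mul]
  ring

theorem contDiff_psiExp (T : Matrix (Fin n) (Fin n) ℂ) (δ A : Matrix (Fin n) (Fin n) ℤ)
    (μ : Fin n → ℂ) : ContDiff ℝ ∞ (psiExp T δ A μ) := by
  have hs := contDiff_star_pi (n := n)
  unfold psiExp
  exact ((((contDiff_const.mul (contDiff_dotProduct_mulVec _ contDiff_id contDiff_id)).add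
    (contDiff_const.mul (contDiff_dotProduct_mulVec _ hs hs))).sub
    (contDiff_dotProduct_mulVec _ contDiff_id hs)).add
    (contDiff_dotProduct_mulVec _ contDiff_const hs)).sub
    (contDiff_dotProduct_mulVec _ contDiff_const contDiff_id)

theorem fderiv_psiExp {T : Matrix (Fin n) (Fin n) ℂ} {δ A : Matrix (Fin n) (Fin n) ℤ}
    (h : (T - toC δ).det ≠ 0) (hA : (toC A * primed T δ)ᵀ = toC A * primed T δ)
    (μ : Fin n → ℂ) (z v : Fin n → ℂ) :
    fderiv ℝ (psiExp T δ A μ) z v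
      = psiCross T δ A z v + μ ⬝ᵥ ((toC δ - T) * diffInv T) *ᵥ star v
        - star μ ⬝ᵥ ((toC δ - cbar T) * diffInv T) *ᵥ v :=
  fderiv_eq_of_line_quadratic ((contDiff_psiExp T δ A μ).differentiable (by simp)).differentiableAt
    (psiExp_line h hA μ z v)

theorem contDiff_psi (hN : N ≠ 0) (T : Matrix (Fin n) (Fin n) ℂ) (δ : Matrix (Fin n) (Fin n) ℤ)
    (r : ℕ) (A : Matrix (Fin n) (Fin n) ℤ) (μ : Fin n → ℂ) :
    ContDiff ℝ ∞ (psi T δ r A μ N) := by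
  rw [funext (psi_eq hN T δ r A μ)]
  exact (contDiff_const.mul (contDiff_psiExp T δ A μ)).cexp

theorem psi_ne_zero (T : Matrix (Fin n) (Fin n) ℂ) (δ : Matrix (Fin n) (Fin n) ℤ)
    (r : ℕ) (A : Matrix (Fin n) (Fin n) ℤ) (μ : Fin n → ℂ) (z : Fin n → ℂ) :
    psi T δ r A μ N z ≠ 0 :=
  Complex.exp_ne_zero _

theorem fderiv_psi (hN : N ≠ 0) {T : Matrix (Fin n) (Fin n) ℂ} {δ A : Matrix (Fin n) (Fin n) ℤ}
    (h : (T - toC δ).det ≠ 0) (hA : (toC A * primed T δ)ᵀ = toC A * primed T δ)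
    (r : ℕ) (μ : Fin n → ℂ) (z v : Fin n → ℂ) :
    fderiv ℝ (psi T δ r A μ N) z v = psi T δ r A μ N z * (I / (2 * Real.pi * r) *
      (psiCross T δ A z v + μ ⬝ᵥ ((toC δ - T) * diffInv T) *ᵥ star v
        - star μ ⬝ᵥ ((toC δ - cbar T) * diffInv T) *ᵥ v)) := by
  have h1 : HasFDerivAt (psiExp T δ A μ) (fderiv ℝ (psiExp T δ A μ) z) z :=
    ((contDiff_psiExp T δ A μ).differentiable (by simp)).differentiableAt.hasFDerivAt
  rw [funext (psi_eq hN T δ r A μ), ((h1.const_mul (I / (2 * Real.pi * r))).cexp).fderiv]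
  simp [fderiv_psiExp h hA]

/-- The scalar connection form of `ℰ_{(r,A,μ,𝒰)}`. -/
noncomputable def flatForm (T : Matrix (Fin n) (Fin n) ℂ) (δ : Matrix (Fin n) (Fin n) ℤ) (r : ℕ)
    (A : Matrix (Fin n) (Fin n) ℤ) (μ z v : Fin n → ℂ) : ℂ :=
  I / (2 * Real.pi * r) * (v ⬝ᵥ redA T δ A *ᵥ star z - v ⬝ᵥ cbar (redA T δ A) *ᵥ star z
    - μ ⬝ᵥ ((toC δ - cbar T) * diffInv T) *ᵥ v + star μ ⬝ᵥ ((toC δ - cbar T) * diffInv T) *ᵥ v)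

theorem flatBundle_conn (hN : N ≠ 0) {T : Matrix (Fin n) (Fin n) ℂ}
    (hT : (T.map Complex.im).det ≠ 0) (δ : Matrix (Fin n) (Fin n) ℤ) (r : ℕ)
    (A : Matrix (Fin n) (Fin n) ℤ) (μ : Fin n → ℂ) (ρ : AutFactor T r A N) (z v : Fin n → ℂ) :
    (flatBundle T δ r A μ ρ).conn z v = flatForm T δ r A μ z v • 1 := by
  simp only [flatBundle, LinearMap.coe_mk, AddHom.coe_mk, formR_eq hN hT δ, flatForm]
  congr 1
  ring

/-- The form has type (1,0): the ∂̄-operator of ℰ is the ordinary one. -/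
theorem flatForm_I_smul (T : Matrix (Fin n) (Fin n) ℂ) (δ : Matrix (Fin n) (Fin n) ℤ) (r : ℕ)
    (A : Matrix (Fin n) (Fin n) ℤ) (μ z v : Fin n → ℂ) :
    flatForm T δ r A μ z (I • v) = I * flatForm T δ r A μ z v := by
  simp only [flatForm, Matrix.mulVec_smul, smul_dotProduct, dotProduct_smul, smul_eq_mul]
  ring

/-- The scalar connection form of `φ^*E_{(r,A,μ,𝒰)}`. -/
noncomputable def pulledForm (T : Matrix (Fin n) (Fin n) ℂ) (δ : Matrix (Fin n) (Fin n) ℤ) (r : ℕ)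
    (A : Matrix (Fin n) (Fin n) ℤ) (μ z v : Fin n → ℂ) : ℂ :=
  I / (2 * Real.pi * r) * ((z - star z) ⬝ᵥ cbar (redA T δ A) *ᵥ v
    - (z - star z) ⬝ᵥ redA T δ A *ᵥ star v
    - μ ⬝ᵥ ((toC δ - cbar T) * diffInv T) *ᵥ v + μ ⬝ᵥ ((toC δ - T) * diffInv T) *ᵥ star v)

/-- `(A X) ⬝ Y` in terms of `z` and `v`, where `X` is a coordinate of `φ(z)` and `Y` of `φ(v)`. -/
theorem dotProduct_coord_primed {T : Matrix (Fin n) (Fin n) ℂ} {δ : Matrix (Fin n) (Fin n) ℤ}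
    (hT : (T.map Complex.im).det ≠ 0) (h : (T - toC δ).det ≠ 0) (A : Matrix (Fin n) (Fin n) ℤ)
    (z v : Fin n → ℂ) :
    toC A *ᵥ (fun i => (coordX (primed T δ) (primed T δ *ᵥ z) i : ℂ)) ⬝ᵥ
        (fun i => (coordY (primed T δ) (primed T δ *ᵥ v) i : ℂ))
      = -((z - star z) ⬝ᵥ cbar (redA T δ A) *ᵥ v - (z - star z) ⬝ᵥ redA T δ A *ᵥ star v) := by
  have ht : ∀ (x y : Fin n → ℂ),
      toC A *ᵥ diffInv T *ᵥ x ⬝ᵥ y = x ⬝ᵥ ((diffInv T)ᵀ * (toC A)ᵀ) *ᵥ y := by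
    intro x y
    rw [← Matrix.transpose_mul, Matrix.mulVec_transpose, Matrix.mulVec_mulVec, dotProduct_comm,
      Matrix.dotProduct_mulVec, dotProduct_comm]
  rw [coordX_primed hT h, coordY_primed hT h, Matrix.mulVec_neg, neg_dotProduct, ht,
    Matrix.mulVec_sub, Matrix.mulVec_mulVec, Matrix.mulVec_mulVec, dotProduct_sub, cbar_redA hT,
    redA]
  simp only [Matrix.mul_assoc]

theorem pulledBundle_conn {T : Matrix (Fin n) (Fin n) ℂ}
    (hT : (T.map Complex.im).det ≠ 0) {δ : Matrix (Fin n) (Fin n) ℤ} (h : (T - toC δ).det ≠ 0)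
    (r : ℕ) (A : Matrix (Fin n) (Fin n) ℤ) (μ : Fin n → ℂ) (𝒰 : SYZUnitaries r A N)
    (z v : Fin n → ℂ) :
    (pulledBundle T hT δ h r A μ 𝒰).conn z v = pulledForm T δ r A μ z v • 1 := by
  change (-(I / (2 * Real.pi * r)) * ∑ i, (∑ j, (A i j : ℂ) *
    coordX (primed T δ) (primed T δ *ᵥ z) j + μ i) * coordY (primed T δ) (primed T δ *ᵥ v) i) •
      (1 : Matrix (Fin N) (Fin N) ℂ) = _
  congr 1
  have h1 : ∑ i, (∑ j, (A i j : ℂ) * coordX (primed T δ) (primed T δ *ᵥ z) j + μ i)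
        * coordY (primed T δ) (primed T δ *ᵥ v) i
      = toC A *ᵥ (fun i => (coordX (primed T δ) (primed T δ *ᵥ z) i : ℂ)) ⬝ᵥ
        (fun i => (coordY (primed T δ) (primed T δ *ᵥ v) i : ℂ))
      + μ ⬝ᵥ (fun i => (coordY (primed T δ) (primed T δ *ᵥ v) i : ℂ)) := by
    rw [← add_dotProduct]
    rfl
  rw [h1, dotProduct_coord_primed hT h, coordY_primed hT h, dotProduct_sub, pulledForm]
  ring

/-- `∂ log Ψ` is the difference of the two connection forms. -/
theorem fderiv_psi_add_flatForm (hN : N ≠ 0) {T : Matrix (Fin n) (Fin n) ℂ}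
    {δ A : Matrix (Fin n) (Fin n) ℤ}
    (h : (T - toC δ).det ≠ 0) (hA : (toC A * primed T δ)ᵀ = toC A * primed T δ)
    (r : ℕ) (μ : Fin n → ℂ) (z v : Fin n → ℂ) :
    fderiv ℝ (psi T δ r A μ N) z v + flatForm T δ r A μ z v * psi T δ r A μ N z
      = psi T δ r A μ N z * pulledForm T δ r A μ z v := by
  -- The only mismatch is between vᵗS̄z̄, from ℛ, and z̄ᵗS̄v, from φ^*E; symmetry of S̄ identifies
  -- them.
  have h1 := dotProduct_mulVec_comm (cbar_redA_transpose h hA) v (star z)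
  rw [fderiv_psi hN h hA, flatForm, pulledForm, psiCross, sub_dotProduct, sub_dotProduct]
  linear_combination -(psi T δ r A μ N z * (I / (2 * Real.pi * r))) * h1

theorem pulledBundle_isHolomorphic {T : Matrix (Fin n) (Fin n) ℂ}
    (hT : (T.map Complex.im).det ≠ 0) {δ A : Matrix (Fin n) (Fin n) ℤ} (h : (T - toC δ).det ≠ 0)
    (hA : (toC A * primed T δ)ᵀ = toC A * primed T δ) (r : ℕ) (μ : Fin n → ℂ)
    (𝒰 : SYZUnitaries r A N) : (pulledBundle T hT δ h r A μ 𝒰).IsHolomorphic := by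
  have hd : ∀ z u v, fderiv ℝ (fun w => pulledForm T δ r A μ w v) z u
      = I / (2 * Real.pi * r) * ((u - star u) ⬝ᵥ cbar (redA T δ A) *ᵥ v
        - (u - star u) ⬝ᵥ redA T δ A *ᵥ star v) := by
    intro z u v
    refine fderiv_eq_of_line_quadratic (b := 0) ?_ fun t => ?_
    · have hs := contDiff_id.sub (contDiff_star_pi (n := n))
      have : ContDiff ℝ ∞ (fun w => pulledForm T δ r A μ w v) := by
        unfold pulledForm
        exact contDiff_const.mul ((((contDiff_dotProduct_mulVec _ hs contDiff_const).sub
          (contDiff_dotProduct_mulVec _ hs contDiff_const)).sub contDiff_const).add contDiff_const)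
      exact (this.differentiable (by simp)).differentiableAt
    · rw [real_smul_pi]
      simp only [pulledForm, star_add, star_real_smul, sub_dotProduct, add_dotProduct,
        smul_dotProduct, smul_eq_mul]
      ring
  intro z u v
  -- Only the terms in ū and v̄ survive in the (0,2)-part: they are ūᵗSv̄ - v̄ᵗSū up to a constant.
  have h1 := dotProduct_mulVec_comm (redA_transpose h hA) (star u) (star v)
  simp only [TorusBundle.curvature_of_scalar _ _ (pulledBundle_conn hT h r A μ 𝒰), hd]
  rw [← smul_assoc, ← smul_assoc, ← add_smul, ← add_smul, ← sub_smul]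
  convert zero_smul ℂ _
  simp only [sub_dotProduct, star_I_smul, Matrix.mulVec_smul, Matrix.mulVec_neg, dotProduct_neg,
    neg_dotProduct, dotProduct_smul, smul_dotProduct, smul_eq_mul]
  have hI : I ^ 3 = -I := by rw [pow_succ, I_sq, neg_one_mul]
  ring_nf
  simp only [hI]
  linear_combination (4 * I * (Real.pi : ℂ)⁻¹ * (r : ℂ)⁻¹ / 2) * h1

theorem pulledBundle_dbar_eq_zero_iff (hN : N ≠ 0) {T : Matrix (Fin n) (Fin n) ℂ}
    (hT : (T.map Complex.im).det ≠ 0) {δ A : Matrix (Fin n) (Fin n) ℤ} (h : (T - toC δ).det ≠ 0)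
    (hA : (toC A * primed T δ)ᵀ = toC A * primed T δ) (r : ℕ) (μ : Fin n → ℂ)
    (𝒰 : SYZUnitaries r A N) {s : (Fin n → ℂ) → (Fin N → ℂ)} {z : Fin n → ℂ}
    (hs : DifferentiableAt ℝ s z) :
    (∀ v, (pulledBundle T hT δ h r A μ 𝒰).dbar s z v = 0) ↔
      DifferentiableAt ℂ (fun z => psi T δ r A μ N z • s z) z := by
  have hp : DifferentiableAt ℝ (psi T δ r A μ N) z :=
    ((contDiff_psi hN T δ r A μ).differentiable (by simp)).differentiableAt
  rw [differentiableAt_complex_iff_fderiv_smul_I (hp.fun_smul hs)]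
  refine forall_congr' fun v => ?_
  -- The derivative of Ψ contributes the form of φ^*E minus the form of ℰ. The latter has type
  -- (1,0), so it cancels in the combination of v and iv.
  have key : fderiv ℝ (fun z => psi T δ r A μ N z • s z) z v
      + I • fderiv ℝ (fun z => psi T δ r A μ N z • s z) z (I • v)
      = psi T δ r A μ N z • (pulledBundle T hT δ h r A μ 𝒰).dbar s z v := by
    have e : ∀ u, fderiv ℝ (psi T δ r A μ N) z u = psi T δ r A μ N z * pulledForm T δ r A μ z u
        - flatForm T δ r A μ z u * psi T δ r A μ N z :=
      fun u => eq_sub_of_add_eq (fderiv_psi_add_flatForm hN h hA r μ z u)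
    rw [fderiv_fun_smul hp hs]
    simp only [TorusBundle.dbar, TorusBundle.covDeriv, pulledBundle_conn, Matrix.smul_mulVec,
      Matrix.one_mulVec]
    ext i
    simp only [_root_.add_apply, _root_.smul_apply, ContinuousLinearMap.smulRight_apply, Pi.add_apply,
      Pi.smul_apply, smul_eq_mul, e, flatForm_I_smul]
    linear_combination (flatForm T δ r A μ z v * psi T δ r A μ N z * s z i) * (-1 : ℂ) * I_sq
  rw [key, smul_eq_zero, or_iff_right (psi_ne_zero T δ r A μ z)]

end Connections

/-! ### The factor of automorphy of φ^*E conjugated by Ψ. -/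

section Factor

variable {n N : ℕ}

/-- The angle, multiplied by `2πr`, of the scalar by which `U(γ)` differs from the unitary matrix
of `φ^*E`. -/
noncomputable def gaugeAngle (T : Matrix (Fin n) (Fin n) ℂ) (δ A : Matrix (Fin n) (Fin n) ℤ)
    (μ g : Fin n → ℂ) : ℂ :=
  psiExp T δ A μ g - ((g - star g) ⬝ᵥ cbar (redA T δ A) *ᵥ g
      - (g - star g) ⬝ᵥ redA T δ A *ᵥ star g)
    - 1 / 2 * (g ⬝ᵥ cbar (redA T δ A) *ᵥ star g - g ⬝ᵥ redA T δ A *ᵥ star g)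

theorem gaugeAngle_real {T : Matrix (Fin n) (Fin n) ℂ} (hT : (T.map Complex.im).det ≠ 0)
    {δ A : Matrix (Fin n) (Fin n) ℤ} (h : (T - toC δ).det ≠ 0)
    (hA : (toC A * primed T δ)ᵀ = toC A * primed T δ) (μ g : Fin n → ℂ) :
    ((gaugeAngle T δ A μ g).re : ℂ) = gaugeAngle T δ A μ g := by
  rw [← Complex.conj_eq_iff_re]
  -- Conjugation exchanges S with S̄ and z with z̄, and it exchanges the two terms in μ and μ̄ with
  -- their signs. Symmetry of S and S̄ then restores the original expression.
  have h1 : ∀ (M : Matrix (Fin n) (Fin n) ℂ) (x y : Fin n → ℂ),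
      conj (x ⬝ᵥ M *ᵥ y) = star x ⬝ᵥ cbar M *ᵥ star y := by
    intro M x y
    rw [star_dotProduct_star', star_mulVec_cbar]
  have e1 : cbar ((toC δ - T) * diffInv T) = -((toC δ - cbar T) * diffInv T) := by
    rw [cbar_mul, cbar_sub, cbar_toC, cbar_diffInv hT, mul_neg]
  have e2 : cbar ((toC δ - cbar T) * diffInv T) = -((toC δ - T) * diffInv T) := by
    rw [cbar_mul, cbar_sub, cbar_toC, cbar_cbar, cbar_diffInv hT, mul_neg]
  have h2 := dotProduct_mulVec_comm (redA_transpose h hA) g (star g)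
  have h3 := dotProduct_mulVec_comm (cbar_redA_transpose h hA) g (star g)
  simp only [gaugeAngle, psiExp, map_sub, map_add, map_mul, map_div₀, map_one, map_ofNat, h1, e1, e2,
    star_star, cbar_cbar, Matrix.neg_mulVec, dotProduct_neg, sub_dotProduct]
  linear_combination (1 / 2) * h2 + (1 / 2) * h3

theorem mulVec_primed_period {T : Matrix (Fin n) (Fin n) ℂ} {δ : Matrix (Fin n) (Fin n) ℤ}
    (h : (T - toC δ).det ≠ 0) (γ : Period n) :
    primed T δ *ᵥ period T γ = period (primed T δ) (-γ.2, γ.1 + δ *ᵥ γ.2) :=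
  (phi T δ h).lin_period γ

/-- The unitary matrices `U(γ)` attached to a family `𝒰`. -/
noncomputable def gaugedUnitary (T : Matrix (Fin n) (Fin n) ℂ) (δ : Matrix (Fin n) (Fin n) ℤ) {r : ℕ}
    {A : Matrix (Fin n) (Fin n) ℤ} (μ : Fin n → ℂ) (𝒰 : SYZUnitaries r A N) (γ : Period n) :
    Matrix.unitaryGroup (Fin N) ℂ :=
  phase N ((gaugeAngle T δ A μ (period T γ)).re / (2 * Real.pi * r)) *
    (powProd 𝒰.V (-γ.2) * powProd 𝒰.U (γ.1 + δ *ᵥ γ.2))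

/-- The quotient Ψ(z + γ)/Ψ(z) is the exponential of a cross term linear in z plus a constant.
Together with the linear exponent of the factor of φ^*E, the cross term becomes ℛ(z,γ)/N. The
constants are what `gaugeAngle` collects: the value at z = 0, less ℛ(γ,γ)/2N. -/
theorem psi_smul_autJ (hN : N ≠ 0) {T : Matrix (Fin n) (Fin n) ℂ}
    (hT : (T.map Complex.im).det ≠ 0) {δ A : Matrix (Fin n) (Fin n) ℤ} (h : (T - toC δ).det ≠ 0)
    (hA : (toC A * primed T δ)ᵀ = toC A * primed T δ) (r : ℕ) (μ : Fin n → ℂ)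
    (𝒰 : SYZUnitaries r A N) (γ : Period n) (z : Fin n → ℂ) :
    psi T δ r A μ N z • autJ T r A (gaugedUnitary T δ μ 𝒰) γ z
      = psi T δ r A μ N (z + period T γ) • (pulledBundle T hT δ h r A μ 𝒰).factor γ z := by
  have hc := coord_period (primed_im_det_ne_zero hT h) (-γ.2, γ.1 + δ *ᵥ γ.2)
  rw [← mulVec_primed_period h γ] at hc
  have hpi : (Real.pi : ℂ) ≠ 0 := by exact_mod_cast Real.pi_ne_zero
  -- The integers -γ₂ are X(φ(γ))/2π, and the shifted Y is the coordinate Y of φ(z + γ). So the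
  -- exponent is the bilinear form (AX)·Y already computed for the connection.
  have e : I / r * ∑ j, ∑ i, (((-γ.2) j : ℤ) : ℂ) * A i j *
      (coordY (primed T δ) (primed T δ *ᵥ z) i + 2 * Real.pi * ((γ.1 + δ *ᵥ γ.2) i : ℤ))
      = I / (2 * Real.pi * r) * (toC A *ᵥ (fun i =>
          (coordX (primed T δ) (primed T δ *ᵥ period T γ) i : ℂ)) ⬝ᵥ
        (fun i => (coordY (primed T δ) (primed T δ *ᵥ (z + period T γ)) i : ℂ))) := by
    rw [Matrix.mulVec_add, map_add, hc.1, hc.2, Finset.sum_comm]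
    simp only [dotProduct, Matrix.mulVec, Finset.mul_sum, Finset.sum_mul]
    refine Finset.sum_congr rfl fun i _ => Finset.sum_congr rfl fun j _ => ?_
    simp only [toC, Matrix.map_apply, Pi.add_apply, Complex.ofReal_add, Complex.ofReal_mul,
      Complex.ofReal_ofNat, Complex.ofReal_intCast]
    field_simp
  have ef : (pulledBundle T hT δ h r A μ 𝒰).factor γ z
      = Complex.exp (I / r * ∑ j, ∑ i, (((-γ.2) j : ℤ) : ℂ) * A i j *
        (coordY (primed T δ) (primed T δ *ᵥ z) i + 2 * Real.pi * ((γ.1 + δ *ᵥ γ.2) i : ℤ))) •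
        ((powProd 𝒰.V (-γ.2) * powProd 𝒰.U (γ.1 + δ *ᵥ γ.2) : Matrix.unitaryGroup (Fin N) ℂ) :
          Matrix (Fin N) (Fin N) ℂ) := rfl
  rw [ef, e, dotProduct_coord_primed hT h, autJ, gaugedUnitary, Submonoid.coe_mul,
    phase_coe, smul_mul_assoc, one_mul, smul_smul, smul_smul, smul_smul, psi_eq hN, psi_eq hN,
    ← Complex.exp_add, ← Complex.exp_add, ← Complex.exp_add]
  congr 2
  set g := period T γ
  have h2 : 1 / (2 * (N : ℂ)) * formR T r A N g g = 1 / 2 * (1 / N * formR T r A N g g) := by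
    field_simp
  rw [h2, formR_eq hN hT δ, formR_eq hN hT δ, psiExp_add h hA]
  push_cast
  rw [gaugeAngle_real hT h hA, gaugeAngle]
  have h3 := dotProduct_mulVec_comm (redA_transpose h hA) g (star z)
  have h4 := dotProduct_mulVec_comm (cbar_redA_transpose h hA) z (star g)
  have h5 := dotProduct_mulVec_comm (cbar_redA_transpose h hA) z g
  have h6 := dotProduct_mulVec_comm (redA_transpose h hA) (star z) (star g)
  simp only [psiCross, star_add, Matrix.mulVec_add, dotProduct_add, sub_dotProduct]
  linear_combination (I / (2 * Real.pi * r)) * (h4 - h5 - h6)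

/-- The factor of automorphy `j` attached to a family `𝒰`. -/
noncomputable def gaugedFactor (hN : N ≠ 0) {T : Matrix (Fin n) (Fin n) ℂ}
    (hT : (T.map Complex.im).det ≠ 0) {δ A : Matrix (Fin n) (Fin n) ℤ} (h : (T - toC δ).det ≠ 0)
    (hA : (toC A * primed T δ)ᵀ = toC A * primed T δ) {r : ℕ} (μ : Fin n → ℂ)
    (𝒰 : SYZUnitaries r A N) : AutFactor T r A N where
  U := gaugedUnitary T δ μ 𝒰
  cocycle γ γ' z := by
    -- j is a gauge transform of a cocycle by a nowhere vanishing scalar function, hence a cocycle.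
    have key : ∀ γ z, autJ T r A (gaugedUnitary T δ μ 𝒰) γ z
        = (psi T δ r A μ N z)⁻¹ • psi T δ r A μ N (z + period T γ) •
          (pulledBundle T hT δ h r A μ 𝒰).factor γ z := fun γ z => by
      rw [← psi_smul_autJ hN hT h hA, inv_smul_smul₀ (psi_ne_zero T δ r A μ z)]
    rw [key, key, key, TorusBundle.factor_add, smul_mul_smul_comm, smul_mul_smul_comm, smul_smul,
      smul_smul, map_add, add_comm (period T γ), add_assoc]
    congr 1
    have h1 := psi_ne_zero (N := N) T δ r A μ z
    have h2 := psi_ne_zero (N := N) T δ r A μ (z + period T γ')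
    field_simp

/-- `Ψ` as an isomorphism of bundles with connection. -/
noncomputable def psiIso (hN : N ≠ 0) {T : Matrix (Fin n) (Fin n) ℂ}
    (hT : (T.map Complex.im).det ≠ 0) {δ A : Matrix (Fin n) (Fin n) ℤ} (h : (T - toC δ).det ≠ 0)
    (hA : (toC A * primed T δ)ᵀ = toC A * primed T δ) {r : ℕ} (μ : Fin n → ℂ)
    (𝒰 : SYZUnitaries r A N) :
    TorusBundle.Iso (pulledBundle T hT δ h r A μ 𝒰)
      (flatBundle T δ r A μ (gaugedFactor hN hT h hA μ 𝒰)) :=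
  TorusBundle.isoOfScalar _ _ (psi T δ r A μ N) (psi_ne_zero T δ r A μ) (contDiff_psi hN T δ r A μ)
    (psi_smul_autJ hN hT h hA r μ 𝒰) (fun z v i j => by
      have hd : DifferentiableAt ℝ (psi T δ r A μ N) z :=
        ((contDiff_psi hN T δ r A μ).differentiable (by simp)).differentiableAt
      have h1 := fderiv_psi_add_flatForm hN h hA r μ z v
      rw [flatBundle_conn hN hT, pulledBundle_conn, smul_mul_smul_comm, smul_mul_smul_comm, ← h1]
      simp only [Matrix.smul_apply, smul_eq_mul, mul_one]
      rw [fderiv_mul_const hd]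
      simp only [_root_.smul_apply, smul_eq_mul]
      ring)

end Factor

/-! ### Factors of automorphy as projective representations of the lattice. -/

section Automorphy

variable {n N : ℕ} {T : Matrix (Fin n) (Fin n) ℂ} {r : ℕ} {A : Matrix (Fin n) (Fin n) ℤ}

theorem formR_zero_left (w : Fin n → ℂ) : formR T r A N 0 w = 0 := by
  simp [formR]

/-- This is the cocycle condition at z = 0. The diagonal terms ℛ(γ,γ) and ℛ(γ',γ') cancel, and only
the antisymmetric part of ℛ remains. -/
theorem AutFactor.U_add (ρ : AutFactor T r A N) (γ γ' : Period n) :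
    (ρ.U (γ + γ') : Matrix (Fin N) (Fin N) ℂ)
      = Complex.exp (1 / (2 * N) * (formR T r A N (period T γ') (period T γ)
          - formR T r A N (period T γ) (period T γ'))) •
        ((ρ.U γ : Matrix (Fin N) (Fin N) ℂ) * (ρ.U γ' : Matrix (Fin N) (Fin N) ℂ)) := by
  have h := ρ.cocycle γ γ' 0
  rw [autJ, autJ, autJ, smul_mul_smul_comm, ← Complex.exp_add,
    ← eq_inv_smul_iff₀ (Complex.exp_ne_zero _), smul_smul, ← Complex.exp_neg, ← Complex.exp_add] at h
  rw [h]
  congr 2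
  simp only [zero_add, formR_zero_left, map_add, formR_add_left, formR_add_right]
  -- For N = 0 the coefficients 1/N and 1/(2N) are both 0 by convention.
  rcases eq_or_ne (N : ℂ) 0 with hN | hN
  · simp [hN]
  · field_simp
    ring

theorem period_eq_sum_generators (γ : Period n) :
    γ = ∑ j, γ.1 j • ((Pi.single j 1, 0) : Period n) + ∑ k, γ.2 k • ((0, Pi.single k 1) : Period n) := by
  ext i <;> simp [Prod.fst_sum, Prod.snd_sum, Finset.sum_apply, Pi.single_apply]

/-- A factor of automorphy is determined by its values on the generators. -/
theorem AutFactor.ext_generators {ρ ρ' : AutFactor T r A N}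
    (h1 : ∀ j, ρ.U (Pi.single j 1, 0) = ρ'.U (Pi.single j 1, 0))
    (h2 : ∀ k, ρ.U (0, Pi.single k 1) = ρ'.U (0, Pi.single k 1)) : ρ = ρ' := by
  have hz : ∀ σ : AutFactor T r A N, σ.U 0 = 1 := fun σ => by
    have := σ.U_add 0 0
    rw [sub_self, mul_zero, Complex.exp_zero, one_smul, ← Submonoid.coe_mul, add_zero] at this
    exact left_eq_mul.1 (Subtype.ext this)
  have hadd : ∀ γ γ', ρ.U γ = ρ'.U γ → ρ.U γ' = ρ'.U γ' → ρ.U (γ + γ') = ρ'.U (γ + γ') := by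
    intro γ γ' h h'
    apply Subtype.ext
    rw [ρ.U_add, ρ'.U_add, h, h']
  -- The periods at which the two maps agree form a subgroup, and it contains the generators.
  let S : AddSubgroup (Period n) :=
    { carrier := {γ | ρ.U γ = ρ'.U γ}
      zero_mem' := (hz ρ).trans (hz ρ').symm
      add_mem' := fun {γ γ'} h h' => hadd γ γ' h h'
      neg_mem' := fun {γ} h => by
        have e1 := ρ.U_add (-γ) γ
        have e2 := ρ'.U_add (-γ) γ
        rw [neg_add_cancel, hz] at e1 e2
        rw [e1, smul_right_inj (Complex.exp_ne_zero _), ← Submonoid.coe_mul, ← Submonoid.coe_mul,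
          ← show ρ.U γ = ρ'.U γ from h] at e2
        exact mul_right_cancel (Subtype.ext e2) }
  refine AutFactor.ext (funext fun γ => ?_)
  change γ ∈ S
  rw [period_eq_sum_generators γ]
  exact S.add_mem (S.sum_mem fun j _ => S.zsmul_mem (h1 j) _)
    (S.sum_mem fun k _ => S.zsmul_mem (h2 k) _)

theorem AutFactor.Extends.unique {δ : Matrix (Fin n) (Fin n) ℤ} {𝒲 : AutUnitaries δ r A N}
    {ρ ρ' : AutFactor T r A N} (h : ρ.Extends 𝒲) (h' : ρ'.Extends 𝒲) : ρ = ρ' :=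
  AutFactor.ext_generators (fun j => (h.1 j).trans (h'.1 j).symm)
    (fun k => (h.2 k).trans (h'.2 k).symm)

end Automorphy

/-! ### Ordered products of powers of commuting elements. -/

section Group

variable {G : Type*} [Group G] {n : ℕ}

theorem powProd_neg (g : Fin n → G) (h : ∀ i j, Commute (g i) (g j)) (a : Fin n → ℤ) :
    powProd g (-a) = (powProd g a)⁻¹ := by
  rw [eq_inv_iff_mul_eq_one, ← powProd_add g h, neg_add_cancel, powProd_zero]

theorem commute_powProd (g : Fin n → G) {x : G} (h : ∀ j, Commute x (g j)) (a : Fin n → ℤ) :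
    Commute x (powProd g a) := by
  refine Commute.list_prod_right _ _ fun y hy => ?_
  obtain ⟨j, rfl⟩ := (List.mem_ofFn' _ _).1 hy
  exact (h j).zpow_right _

end Group

/-! ### Commutators of U(γ), and the bijection between the two kinds of families. -/

section Correspondence

variable {n N : ℕ} {r : ℕ} {A δ : Matrix (Fin n) (Fin n) ℤ}

theorem zetaRoot_zpow (m : ℤ) :
    zetaRoot r ^ m = Complex.exp (((2 * Real.pi / r * m : ℝ) : ℂ) * I) := by
  rw [zetaRoot, ← Complex.exp_int_mul]
  congr 1
  push_cast
  ring

theorem zetaRoot_smul_eq_iff (m : ℤ) (x y x' y' : Matrix.unitaryGroup (Fin N) ℂ) :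
    zetaRoot r ^ m • ((x : Matrix (Fin N) (Fin N) ℂ) * (y : Matrix (Fin N) (Fin N) ℂ))
        = (x' : Matrix (Fin N) (Fin N) ℂ) * (y' : Matrix (Fin N) (Fin N) ℂ) ↔
      phase N (2 * Real.pi / r * m) * (x * y) = x' * y' := by
  rw [Subtype.ext_iff, Submonoid.coe_mul, phase_coe, smul_mul_assoc, one_mul, Submonoid.coe_mul,
    Submonoid.coe_mul, zetaRoot_zpow]

theorem phase_neg_mul_eq_iff (t : ℝ) (x y : Matrix.unitaryGroup (Fin N) ℂ) :
    phase N (-t) * x = y ↔ x = phase N t * y := by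
  have h : phase N (-t) = (phase N t)⁻¹ := by
    rw [eq_inv_iff_mul_eq_one, ← phase_add, neg_add_cancel, phase_zero]
  rw [h, inv_mul_eq_iff_eq_mul]

/-- The integer that measures how `U(γ)` and `U(γ')` fail to commute. -/
def commutatorExp (δ A : Matrix (Fin n) (Fin n) ℤ) (γ γ' : Period n) : ℤ :=
  γ.1 ⬝ᵥ A *ᵥ γ'.2 - γ'.1 ⬝ᵥ A *ᵥ γ.2 + γ.2 ⬝ᵥ (δᵀ * A) *ᵥ γ'.2 - γ'.2 ⬝ᵥ (δᵀ * A) *ᵥ γ.2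

theorem period_eq (T : Matrix (Fin n) (Fin n) ℂ) (γ : Period n) :
    period T γ = (2 * (Real.pi : ℂ)) • ((fun i => (γ.1 i : ℂ)) + T *ᵥ (fun i => (γ.2 i : ℂ))) :=
  rfl

theorem intCast_dotProduct_mulVec (M : Matrix (Fin n) (Fin n) ℤ) (a b : Fin n → ℤ) :
    ((a ⬝ᵥ M *ᵥ b : ℤ) : ℂ) = (fun i => (a i : ℂ)) ⬝ᵥ toC M *ᵥ (fun i => (b i : ℂ)) := by
  simp [dotProduct, Matrix.mulVec, toC]

theorem toC_mul (M M' : Matrix (Fin n) (Fin n) ℤ) : toC (M * M') = toC M * toC M' :=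
  Matrix.map_mul (f := Int.castRingHom ℂ)

theorem toC_transpose (M : Matrix (Fin n) (Fin n) ℤ) : toC Mᵀ = (toC M)ᵀ := rfl

/-- With B = S̄ - S, which is symmetric and equal to AD, the form ℛ is a multiple of zᵗBw̄. For a
lattice vector, Bγ̄ = Bγ - 2πAγ₂. The terms in γᵗBγ' cancel by symmetry, and integral pairings with
A are left. -/
theorem formR_sub_swap (hN : N ≠ 0) {T : Matrix (Fin n) (Fin n) ℂ}
    (hT : (T.map Complex.im).det ≠ 0) (h : (T - toC δ).det ≠ 0)
    (hA : (toC A * primed T δ)ᵀ = toC A * primed T δ) (γ γ' : Period n) :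
    1 / N * (formR T r A N (period T γ') (period T γ) - formR T r A N (period T γ) (period T γ'))
      = ((2 * Real.pi / r * commutatorExp δ A γ γ' : ℝ) : ℂ) * I := by
  set B := cbar (redA T δ A) - redA T δ A with hB
  have hBs : Bᵀ = B := by
    rw [hB, Matrix.transpose_sub, cbar_redA_transpose h hA, redA_transpose h hA]
  have hBA : B = toC A * diffInv T := by
    rw [← hBs, hB, ← cbar_redA_sub hT, Matrix.transpose_mul, Matrix.transpose_transpose,
      Matrix.transpose_transpose]
  have hR : ∀ z w, 1 / N * formR T r A N z w = I / (2 * Real.pi * r) * (z ⬝ᵥ B *ᵥ star w) := by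
    intro z w
    rw [formR_eq hN hT δ, hB, Matrix.sub_mulVec, dotProduct_sub]
  have hstar : ∀ γ : Period n, B *ᵥ star (period T γ)
      = B *ᵥ period T γ - (2 * (Real.pi : ℂ)) • (toC A *ᵥ (fun i => (γ.2 i : ℂ))) := by
    intro γ
    have e : star (period T γ) = period T γ
        - (2 * (Real.pi : ℂ)) • ((T - cbar T) *ᵥ (fun i => (γ.2 i : ℂ))) := by
      have hs : ∀ x : Fin n → ℤ, star (fun i => (x i : ℂ)) = fun i => (x i : ℂ) := fun x => by
        ext i
        simp
      have hs2 : ∀ v : Fin n → ℂ, star ((2 * (Real.pi : ℂ)) • v) = (2 * (Real.pi : ℂ)) • star v :=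
        fun v => by
          ext i
          simp
      rw [period_eq, hs2, star_add, star_mulVec_cbar, hs, hs, Matrix.sub_mulVec, ← smul_sub]
      congr 1
      abel
    rw [e, Matrix.mulVec_sub, Matrix.mulVec_smul, Matrix.mulVec_mulVec, hBA, Matrix.mul_assoc,
      diffInv_mul hT, Matrix.mul_one]
  -- TᵗA = δᵗA - (δ - T)ᵗA, and the last matrix is symmetric. Antisymmetrising therefore replaces T
  -- by the integral matrix δ.
  have hTA : ∀ x y : Fin n → ℂ, (T *ᵥ x) ⬝ᵥ toC A *ᵥ y - (T *ᵥ y) ⬝ᵥ toC A *ᵥ x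
      = x ⬝ᵥ toC (δᵀ * A) *ᵥ y - y ⬝ᵥ toC (δᵀ * A) *ᵥ x := by
    intro x y
    have hsym := transpose_mul_symm h hA
    have ht : ∀ x y : Fin n → ℂ, (T *ᵥ x) ⬝ᵥ toC A *ᵥ y
        = x ⬝ᵥ toC (δᵀ * A) *ᵥ y - x ⬝ᵥ ((toC A)ᵀ * (toC δ - T)) *ᵥ y := by
      intro x y
      rw [← hsym, Matrix.transpose_mul, Matrix.transpose_transpose, toC_mul, toC_transpose,
        ← dotProduct_sub, ← Matrix.sub_mulVec, ← Matrix.sub_mul, ← Matrix.transpose_sub,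
        sub_sub_cancel, ← Matrix.mulVec_mulVec, Matrix.dotProduct_mulVec x, Matrix.vecMul_transpose]
    rw [ht, ht, dotProduct_mulVec_comm hsym x y]
    ring
  have hsw := dotProduct_mulVec_comm hBs (period T γ) (period T γ')
  have key := hTA (fun i => (γ.2 i : ℂ)) (fun i => (γ'.2 i : ℂ))
  have hpi : (Real.pi : ℂ) ≠ 0 := by exact_mod_cast Real.pi_ne_zero
  rw [mul_sub, hR, hR, hstar, hstar, dotProduct_sub, dotProduct_sub, hsw, commutatorExp]
  push_cast [intCast_dotProduct_mulVec]
  simp only [period_eq, dotProduct_smul, smul_dotProduct, add_dotProduct, smul_eq_mul]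
  have hscal : I / (2 * (Real.pi : ℂ) * r) * (2 * Real.pi * (2 * Real.pi)) = 2 * Real.pi / r * I := by
    rcases eq_or_ne (r : ℂ) 0 with hr | hr
    · simp [hr]
    · field_simp
  linear_combination (I / (2 * (Real.pi : ℂ) * r) * (2 * Real.pi * (2 * Real.pi))) * key
    + ((fun i => (γ.1 i : ℂ)) ⬝ᵥ toC A *ᵥ (fun i => (γ'.2 i : ℂ))
      - (fun i => (γ'.1 i : ℂ)) ⬝ᵥ toC A *ᵥ (fun i => (γ.2 i : ℂ))
      + (fun i => (γ.2 i : ℂ)) ⬝ᵥ toC (δᵀ * A) *ᵥ (fun i => (γ'.2 i : ℂ))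
      - (fun i => (γ'.2 i : ℂ)) ⬝ᵥ toC (δᵀ * A) *ᵥ (fun i => (γ.2 i : ℂ))) * hscal

/-- The two expansions of U(γ + γ') = U(γ' + γ) by `AutFactor.U_add` differ by opposite exponents.
-/
theorem AutFactor.U_comm (hN : N ≠ 0) {T : Matrix (Fin n) (Fin n) ℂ}
    (hT : (T.map Complex.im).det ≠ 0) (h : (T - toC δ).det ≠ 0)
    (hA : (toC A * primed T δ)ᵀ = toC A * primed T δ) (ρ : AutFactor T r A N) (γ γ' : Period n) :
    zetaRoot r ^ commutatorExp δ A γ γ' •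
        ((ρ.U γ : Matrix (Fin N) (Fin N) ℂ) * (ρ.U γ' : Matrix (Fin N) (Fin N) ℂ))
      = (ρ.U γ' : Matrix (Fin N) (Fin N) ℂ) * (ρ.U γ : Matrix (Fin N) (Fin N) ℂ) := by
  have h1 := ρ.U_add γ γ'
  rw [add_comm, ρ.U_add, ← eq_inv_smul_iff₀ (Complex.exp_ne_zero _), smul_smul, ← Complex.exp_neg,
    ← Complex.exp_add] at h1
  rw [h1, zetaRoot_zpow, ← formR_sub_swap hN hT h hA]
  congr 2
  have : (N : ℂ) ≠ 0 := Nat.cast_ne_zero.2 hN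
  field_simp
  ring

theorem dotProduct_single_mulVec_single (M : Matrix (Fin n) (Fin n) ℤ) (j k : Fin n) :
    (Pi.single j 1 : Fin n → ℤ) ⬝ᵥ M *ᵥ (Pi.single k 1 : Fin n → ℤ) = M j k := by
  simp

theorem transpose_mul_apply_swap (M M' : Matrix (Fin n) (Fin n) ℤ) (j k : Fin n) :
    (Mᵀ * M') j k = (M'ᵀ * M) k j := by
  rw [← Matrix.transpose_apply (M'ᵀ * M), Matrix.transpose_mul, Matrix.transpose_transpose]

/-- The values of a factor of automorphy on the generators. -/
def AutFactor.toUnitaries (hN : N ≠ 0) {T : Matrix (Fin n) (Fin n) ℂ}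
    (hT : (T.map Complex.im).det ≠ 0) (h : (T - toC δ).det ≠ 0)
    (hA : (toC A * primed T δ)ᵀ = toC A * primed T δ) (ρ : AutFactor T r A N) :
    AutUnitaries δ r A N where
  W j := ρ.U (Pi.single j 1, 0)
  W' k := ρ.U (0, Pi.single k 1)
  W_comm j k := by
    have := ρ.U_comm hN hT h hA (Pi.single j 1, 0) (Pi.single k 1, 0)
    apply Subtype.ext
    simpa [commutatorExp] using this
  W'_comm j k := by
    -- In this order the exponent is (δᵗA)_{kj} - (δᵗA)_{jk}, which is (Aᵗδ)_{jk} - (Aᵗδ)_{kj}.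
    have := ρ.U_comm hN hT h hA (0, Pi.single k 1) (0, Pi.single j 1)
    rw [← this, commutatorExp]
    simp only [dotProduct_single_mulVec_single, zero_dotProduct, sub_zero, zero_add,
      transpose_mul_apply_swap δ]
  W'_W j k := by
    have := ρ.U_comm hN hT h hA (0, Pi.single k 1) (Pi.single j 1, 0)
    rw [← this, commutatorExp]
    simp only [dotProduct_single_mulVec_single, zero_dotProduct, zero_sub, Matrix.mulVec_zero,
      dotProduct_zero, add_zero, sub_zero]

theorem gaugedUnitary_single_left {T : Matrix (Fin n) (Fin n) ℂ} (μ : Fin n → ℂ)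
    (𝒰 : SYZUnitaries r A N) (j : Fin n) :
    gaugedUnitary T δ μ 𝒰 (Pi.single j 1, 0)
      = phase N ((gaugeAngle T δ A μ (period T (Pi.single j 1, 0))).re / (2 * Real.pi * r)) *
        𝒰.U j := by
  simp [gaugedUnitary, powProd_zero, powProd_single]

/-- On periods φ takes (0, e_k) to (-e_k, δe_k): this accounts for the inverse of V_k and for the
k-th column of δ. -/
theorem gaugedUnitary_single_right {T : Matrix (Fin n) (Fin n) ℂ} (μ : Fin n → ℂ)
    (𝒰 : SYZUnitaries r A N) (k : Fin n) :
    gaugedUnitary T δ μ 𝒰 (0, Pi.single k 1)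
      = phase N ((gaugeAngle T δ A μ (period T (0, Pi.single k 1))).re / (2 * Real.pi * r)) *
        ((𝒰.V k)⁻¹ * powProd 𝒰.U (fun l => δ l k)) := by
  rw [gaugedUnitary, powProd_neg _ 𝒰.V_comm, powProd_single, zero_add]
  congr 4
  ext l
  simp

/-- The family `𝒰` with prescribed matrices on the generators, up to the scalars `s`, `t`. -/
noncomputable def AutUnitaries.toSYZ (𝒲 : AutUnitaries δ r A N) (s t : Fin n → ℝ) :
    SYZUnitaries r A N := by
  have hWW : ∀ j k, 𝒲.W' k * 𝒲.W j = phase N (2 * Real.pi / r * A j k) * (𝒲.W j * 𝒲.W' k) := by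
    intro j k
    have := 𝒲.W'_W j k
    rw [zetaRoot_smul_eq_iff, Int.cast_neg, mul_neg, phase_neg_mul_eq_iff] at this
    exact this
  have hUc : ∀ i j, Commute (phase N (s i) * 𝒲.W i) (phase N (s j) * 𝒲.W j) := fun i j =>
    (phase_commute _ _).mul_left ((phase_commute _ _).symm.mul_right (𝒲.W_comm i j))
  have hconj : ∀ j k, 𝒲.W' k * (phase N (s j) * 𝒲.W j) * (𝒲.W' k)⁻¹
      = phase N (2 * Real.pi / r * A j k) * (phase N (s j) * 𝒲.W j) := by
    intro j k
    rw [mul_inv_eq_iff_eq_mul, ← mul_assoc, ← (phase_commute (s j) (𝒲.W' k)).eq, mul_assoc, hWW,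
      ← mul_assoc, (phase_commute (s j) _).eq]
    simp only [mul_assoc]
  have hconjP : ∀ k l, 𝒲.W' k * powProd (fun i => phase N (s i) * 𝒲.W i) (fun i => δ i l)
        * (𝒲.W' k)⁻¹ = phase N (2 * Real.pi / r * ((Aᵀ * δ) k l : ℤ)) *
        powProd (fun i => phase N (s i) * 𝒲.W i) (fun i => δ i l) := by
    intro k l
    rw [conj_powProd _ _ _ (fun j y => phase_commute _ y) (fun j => hconj j k), powProd_phase]
    congr 2
    simp only [Matrix.mul_apply, Matrix.transpose_apply]
    push_cast
    rw [Finset.mul_sum]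
    exact Finset.sum_congr rfl fun i _ => by ring
  -- These solve W_j = (phase) U_j and W'_k = (phase) V_k⁻¹P_k, where P_k is the product of the
  -- U_l^{δ_lk}. Phases are central, so they do not affect the relations.
  set U : Fin n → Matrix.unitaryGroup (Fin N) ℂ := fun i => phase N (s i) * 𝒲.W i with hU
  set P : Fin n → Matrix.unitaryGroup (Fin N) ℂ := fun l => powProd U (fun i => δ i l) with hP
  have hPU : ∀ k l, Commute (U k) (P l) := fun k l => commute_powProd _ (fun j => hUc k j) _
  have hPP : ∀ k l, Commute (P k) (P l) := fun k l =>
    commute_powProd _ (fun j => (hPU j k).symm) _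
  have hPW : ∀ k l, (P l)⁻¹ * 𝒲.W' k
      = phase N (2 * Real.pi / r * ((Aᵀ * δ) k l : ℤ)) * (𝒲.W' k * (P l)⁻¹) := by
    intro k l
    have h1 := hconjP k l
    rw [mul_inv_eq_iff_eq_mul] at h1
    rw [← mul_assoc, eq_mul_inv_iff_mul_eq, mul_assoc, h1, ← mul_assoc, ← mul_assoc,
      ← (phase_commute _ (P l)⁻¹).eq, mul_assoc, mul_assoc, inv_mul_cancel_left]
  -- Moving P_j⁻¹ past W'_k costs ζ^{(Aᵗδ)_{kj}}, and the opposite order costs ζ^{(Aᵗδ)_{jk}}. Their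
  -- quotient compensates the commutator of W'_j and W'_k.
  have hM : ∀ j k, Commute (𝒲.W' j * (P j)⁻¹) (𝒲.W' k * (P k)⁻¹) := by
    intro j k
    have e : ∀ j k, 𝒲.W' j * (P j)⁻¹ * (𝒲.W' k * (P k)⁻¹)
        = phase N (2 * Real.pi / r * ((Aᵀ * δ) k j : ℤ)) *
          (𝒲.W' j * 𝒲.W' k * ((P j)⁻¹ * (P k)⁻¹)) := by
      intro j k
      calc _ = 𝒲.W' j * ((P j)⁻¹ * 𝒲.W' k) * (P k)⁻¹ := by simp only [mul_assoc]
        _ = _ := by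
          rw [hPW, ← mul_assoc (𝒲.W' j), ← (phase_commute _ (𝒲.W' j)).eq]
          simp only [mul_assoc]
    have hW := (zetaRoot_smul_eq_iff _ _ _ _ _).1 (𝒲.W'_comm j k).symm
    rw [Commute, SemiconjBy, e, e, ← hW, ((hPP j k).inv_inv).eq, mul_assoc (phase N _),
      ← mul_assoc (phase N _), ← phase_add]
    congr 2
    push_cast
    ring
  exact
  { V := fun k => phase N (t k) * (𝒲.W' k * (P k)⁻¹)⁻¹
    U := U
    V_comm := fun j k => (phase_commute _ _).mul_left
      ((phase_commute _ _).symm.mul_right (hM j k).inv_inv)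
    U_comm := hUc
    U_V := fun j k => by
      have h1 : 𝒲.W' j * (P j)⁻¹ * U k
          = phase N (2 * Real.pi / r * A k j) * (U k * (𝒲.W' j * (P j)⁻¹)) := by
        have h2 := hconj k j
        rw [mul_inv_eq_iff_eq_mul] at h2
        rw [mul_assoc, ((hPU k j).symm.inv_left).eq, ← mul_assoc, h2]
        simp only [mul_assoc, hU]
      rw [zetaRoot_smul_eq_iff, Int.cast_neg, mul_neg, phase_neg_mul_eq_iff]
      have h3 : U k * (𝒲.W' j * (P j)⁻¹)⁻¹
          = phase N (2 * Real.pi / r * A k j) * ((𝒲.W' j * (P j)⁻¹)⁻¹ * U k) := by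
        rw [mul_inv_eq_iff_eq_mul, mul_assoc, mul_assoc, (phase_commute _ _).left_comm, ← h1,
          inv_mul_cancel_left]
      rw [(phase_commute (t j) (U k)).symm.left_comm, h3, (phase_commute (t j) _).left_comm,
        mul_assoc] }

theorem AutUnitaries.toSYZ_U (𝒲 : AutUnitaries δ r A N) (s t : Fin n → ℝ) :
    (𝒲.toSYZ s t).U = fun i => phase N (s i) * 𝒲.W i :=
  rfl

theorem AutUnitaries.toSYZ_V (𝒲 : AutUnitaries δ r A N) (s t : Fin n → ℝ) (k : Fin n) :
    (𝒲.toSYZ s t).V k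
      = phase N (t k) * (𝒲.W' k * (powProd (𝒲.toSYZ s t).U fun l => δ l k)⁻¹)⁻¹ :=
  rfl

theorem toUnitaries_gaugedFactor_bijective (hN : N ≠ 0) {T : Matrix (Fin n) (Fin n) ℂ}
    (hT : (T.map Complex.im).det ≠ 0) (h : (T - toC δ).det ≠ 0)
    (hA : (toC A * primed T δ)ᵀ = toC A * primed T δ) (μ : Fin n → ℂ) :
    Function.Bijective fun 𝒰 : SYZUnitaries r A N =>
      (gaugedFactor hN hT h hA μ 𝒰).toUnitaries hN hT h hA := by
  constructor
  · intro 𝒰 𝒰' he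
    have hW : ∀ j, gaugedUnitary T δ μ 𝒰 (Pi.single j 1, 0)
        = gaugedUnitary T δ μ 𝒰' (Pi.single j 1, 0) := fun j =>
      congrFun (congrArg AutUnitaries.W he) j
    have hW' : ∀ k, gaugedUnitary T δ μ 𝒰 (0, Pi.single k 1)
        = gaugedUnitary T δ μ 𝒰' (0, Pi.single k 1) := fun k =>
      congrFun (congrArg AutUnitaries.W' he) k
    -- The phases depend on μ and γ but not on the family. So U is recovered first, and V only after
    -- it, since W'_k involves U as well.
    simp only [gaugedUnitary_single_left, mul_right_inj] at hW
    simp only [gaugedUnitary_single_right, mul_right_inj, funext hW, mul_left_inj, _root_.inv_inj] at hW'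
    exact SYZUnitaries.ext (funext hW') (funext hW)
  · intro 𝒲
    -- The phases have opposite signs because U_j enters U(γ_j) directly, while V_k enters U(γ'_k)
    -- through its inverse.
    refine ⟨𝒲.toSYZ
      (fun j => -((gaugeAngle T δ A μ (period T (Pi.single j 1, 0))).re / (2 * Real.pi * r)))
      (fun k => (gaugeAngle T δ A μ (period T (0, Pi.single k 1))).re / (2 * Real.pi * r)), ?_⟩
    refine AutUnitaries.ext (funext fun j => ?_) (funext fun k => ?_)
    · change gaugedUnitary T δ μ _ _ = _
      rw [gaugedUnitary_single_left, AutUnitaries.toSYZ_U, ← mul_assoc, ← phase_add, add_neg_cancel,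
        phase_zero, one_mul]
    · change gaugedUnitary T δ μ _ _ = _
      rw [gaugedUnitary_single_right, AutUnitaries.toSYZ_V,
        (phase_commute _ (𝒲.W' k * _⁻¹)⁻¹).eq, _root_.mul_inv_rev, inv_inv, ← mul_assoc,
        mul_inv_cancel_left, inv_mul_cancel_right]

end Correspondence

/-! ### Positivity of the rank, projective flatness and the main theorem. -/

theorem SmithForm.rank_ne_zero {n : ℕ} {A : Matrix (Fin n) (Fin n) ℤ} (S : SmithForm A) {r : ℕ}
    (hr : 0 < r) : S.rank r ≠ 0 := by
  refine Finset.prod_ne_zero_iff.2 fun i _ => (Nat.div_pos ?_ (Nat.gcd_pos_of_pos_left _ hr)).ne'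
  exact Nat.gcd_le_left _ hr

theorem flatBundle_isProjectivelyFlat {n N : ℕ} (hN : N ≠ 0) {T : Matrix (Fin n) (Fin n) ℂ}
    (hT : (T.map Complex.im).det ≠ 0) (δ : Matrix (Fin n) (Fin n) ℤ) (r : ℕ)
    (A : Matrix (Fin n) (Fin n) ℤ) (μ : Fin n → ℂ) (ρ : AutFactor T r A N) :
    (flatBundle T δ r A μ ρ).IsProjectivelyFlat :=
  ⟨_, TorusBundle.curvature_of_scalar _ _ (flatBundle_conn hN hT δ r A μ ρ)⟩

theorem theorem5p1 {n : ℕ} (T : Matrix (Fin n) (Fin n) ℂ) (hdet : T.det = 0)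
    (hT : ∀ x : Fin n → ℝ, x ≠ 0 → 0 < x ⬝ᵥ T.map Complex.im *ᵥ x)
    (δ : Matrix (Fin n) (Fin n) ℤ) (hδ : (T - toC δ).det ≠ 0)
    (r : ℕ) (hr : 0 < r) (A : Matrix (Fin n) (Fin n) ℤ) (S : SmithForm A)
    (hA : (toC A * primed T δ)ᵀ = toC A * primed T δ) (μ : Fin n → ℂ) :
    -- each family of matrices `U(γ_j)`, `U(γ'_k)` comes from exactly one factor of automorphy `j`
    (∀ 𝒲 : AutUnitaries δ r A (S.rank r),
      ∃! ρ : AutFactor T r A (S.rank r), ρ.Extends 𝒲) ∧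
    -- the families `𝒰` for the two kinds of bundles correspond to each other bijectively
    ∃ Θ : SYZUnitaries r A (S.rank r) ≃ AutUnitaries δ r A (S.rank r),
      ∀ (𝒰 : SYZUnitaries r A (S.rank r)) (ρ : AutFactor T r A (S.rank r)), ρ.Extends (Θ 𝒰) →
        (flatBundle T δ r A μ ρ).IsProjectivelyFlat ∧
        (pulledBundle T (im_det_ne_zero hT) δ hδ r A μ 𝒰).IsHolomorphic ∧
        (∃ F : TorusBundle.Iso (pulledBundle T (im_det_ne_zero hT) δ hδ r A μ 𝒰)
            (flatBundle T δ r A μ ρ),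
          ∀ z, F.lift z = psi T δ r A μ (S.rank r) z • 1) ∧
        -- `Ψ` carries the local holomorphic sections of `φ^*E` to those of `ℰ`
        ∀ (Ω : Set (Fin n → ℂ)) (s : (Fin n → ℂ) → (Fin (S.rank r) → ℂ)), IsOpen Ω →
          ContDiffOn ℝ ∞ s Ω →
          ((∀ z ∈ Ω, ∀ v, (pulledBundle T (im_det_ne_zero hT) δ hδ r A μ 𝒰).dbar s z v = 0) ↔
            DifferentiableOn ℂ (fun z => psi T δ r A μ (S.rank r) z • s z) Ω) := by
  have hN := S.rank_ne_zero hr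
  have hT' := im_det_ne_zero hT
  have hext : ∀ 𝒰 : SYZUnitaries r A (S.rank r), (gaugedFactor hN hT' hδ hA μ 𝒰).Extends
      ((gaugedFactor hN hT' hδ hA μ 𝒰).toUnitaries hN hT' hδ hA) :=
    fun 𝒰 => ⟨fun _ => rfl, fun _ => rfl⟩
  let Θ := Equiv.ofBijective _ (toUnitaries_gaugedFactor_bijective (r := r) hN hT' hδ hA μ)
  refine ⟨fun 𝒲 => ?_, Θ, fun 𝒰 ρ hρ => ?_⟩
  -- Existence of the extension comes from surjectivity: the family arises from some 𝒰, whose gauged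
  -- factor extends it.
  · obtain ⟨𝒰, rfl⟩ := Θ.surjective 𝒲
    exact ⟨_, hext 𝒰, fun ρ hρ => hρ.unique (hext 𝒰)⟩
  -- Uniqueness of the extension reduces an arbitrary ρ to the one for which Ψ was built.
  · obtain rfl : ρ = gaugedFactor hN hT' hδ hA μ 𝒰 := hρ.unique (hext 𝒰)
    refine ⟨flatBundle_isProjectivelyFlat hN hT' δ r A μ _,
      pulledBundle_isHolomorphic hT' hδ hA r μ 𝒰,
      ⟨psiIso hN hT' hδ hA μ 𝒰, fun z => rfl⟩, fun Ω s hΩ hs => ?_⟩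
    refine forall₂_congr fun z hz => ?_
    have hd : DifferentiableAt ℝ s z :=
      (hs.contDiffAt (hΩ.mem_nhds hz)).differentiableAt (by simp)
    rw [pulledBundle_dbar_eq_zero_iff hN hT' hδ hA r μ 𝒰 hd]
    exact ⟨fun h => h.differentiableWithinAt, fun h => h.differentiableAt (hΩ.mem_nhds hz)⟩
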